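/- **Setting.** Let $f:\mathbb R^n\to\mathbb R^n$ be locally Lipschitz and such that $\dot{\mathbf x}=f(\mathbf x)$, $\mathbf x(0)=x$, has a solution on $[0,\infty)$ for every $x$; let $\phi(t,x)$ be the resulting flow. Let $h:\mathbb R^n\to\mathbb R$ be bounded and locally Lipschitz, let $\eta:\mathbb R^n\to[0,\infty)$ be locally Lipschitz, and put $$\mathcal T_th(x)=\exp\Big\{-\int_0^t\eta(\phi(r,x))\,dr\Big\}\,h(\phi(t,x)),\qquad t\ge 0 .$$ For a real function $v$, let $\partial^+v(x)$ be the set of $p$ with $\limsup_{y\to x}\frac{v(y)-v(x)-p\cdot(y-x)}{|y-x|}\le 0$ and $\partial^-v(x)$ the set of $q$ with $\liminf_{y\to x}\frac{v(y)-v(x)-q\cdot(y-x)}{|y-x|}\ge 0$. A continuous $v$ is a viscosity solution of $F(x,v,\nabla v)=0$ on an open set if at each of its points $F(x,v(x),p)\le 0$ for all $p\in\partial^+v(x)$ and $F(x,v(x),q)\ge0$ for all $q\in\partial^-v(x)$ (the function $F$ need not be continuous in $x$). **(1)** $u_h(t,x)=\mathcal T_th(x)$ is the unique function, continuous on $[0,\infty)\times\mathbb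 R^n$, that is a viscosity solution on $(0,\infty)\times\mathbb R^n$ of $\partial_tu-\nabla_xu\cdot f(x)+\eta(x)u=0$ and satisfies $u(0,\cdot)=h$. Suppose now moreover that $f(x_{\rm eq})=0$; that $x_{\rm eq}$ is locally exponentially stable (there are $\delta,M,c>0$ with $|\phi(t,x)-x_{\rm eq}|\le M|x-x_{\rm eq}|e^{-ct}$ for all $t\ge0$ whenever $|x-x_{\rm eq}|\le\delta$), with region of attraction $\mathcal D=\{x:\phi(t,x)\to x_{\rm eq}\text{ as }t\to\infty\}$; and that $\eta(x_{\rm eq})=0$ and $\eta(x)>0$ for $x\ne x_{\rm eq}$. Let $V(x)=\int_0^\infty\eta(\phi(t,x))\,dt\in[0,\infty]$, and let $U_h(x)=e^{-V(x)}h(\lim_{t\to\infty}\phi(t,x))$ if $V(x)<\infty$ and $U_h(x)=0$ otherwise. For every $t>0$ and $k\in\mathbb N$ let $\mathfrak u^t_k$ be bounded and locally Lipschitz, and let the residuals $\vartheta^t_k=\mathcal T_th-\mathfrak u^t_k$ be, for each $t$, bounded uniformly in $k$, with $\vartheta^t_k(x_{\rm eq})=0$, and with $\sup_{x\in\Omega}|\vartheta^t_k(x)|\to0$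 as $k\to\infty$ for each $t>0$ and each bounded $\Omega\subset\mathbb R^n$. **(2)** Assume that $\inf_{|x-x_{\rm eq}|\ge r}\eta(x)>0$ for every $r>0$. Then $\mathfrak u^t_k\to U_h$ uniformly on bounded sets as $k\to\infty$ and then $t\to\infty$: for every $\varepsilon>0$ there is $T$ such that for all $t\ge T$ and all bounded $\Omega$ one has $\sup_{\Omega}|\mathfrak u^t_k-U_h|\le\varepsilon$ for all sufficiently large $k$. Moreover, on every set $\Omega\subseteq\mathbb R^n$ (bounded or not) on which $\vartheta^t_k\to0$ uniformly as $(t,k)\to(\infty,\infty)$ jointly, also $\mathfrak u^t_k\to U_h$ uniformly as $(t,k)\to(\infty,\infty)$ jointly. **(3)** Assume that $h(x_{\rm eq})=1$ and that $\vartheta^t_k$ is Lipschitz with constant $L^t_k$, where $L^t_k\to0$ as $k\to\infty$ for every $t>0$. Then there are functions $\mathcal O^t_k:\mathbb R^n\to\mathbb R$ (not necessarily continuous) with the following properties. (a) For all $t>0$ and $k$, the function $\mathfrak v^t_k=-\log\mathfrak u^t_k$, defined on the open set $\{\mathfrak u^t_k>0\}\ni x_{\rm eq}$, is a viscosity solution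 there of $$-\nabla\mathfrak v(x)\cdot f(x)-\eta(x)+\mathcal O^t_k(x)=0,\qquad \mathfrak v(x_{\rm eq})=0 .$$ (b) On every open set $\Omega\subseteq\mathcal D\cap\{\mathfrak u^t_k>0\}$ that contains $x_{\rm eq}$ and is forward invariant under $\phi$, $\mathfrak v^t_k$ is the only viscosity solution of this problem among locally Lipschitz functions on $\Omega$, and the only one among all continuous functions on $\Omega$ if $\mathcal O^t_k$ is continuous on $\Omega$. (c) The error vanishes locally uniformly on the region of attraction: for every compact $K\subset\mathcal D$ and $\varepsilon>0$ there is $T$ such that for every $t\ge T$ and all sufficiently large $k$ (depending on $t$), $\mathfrak u^t_k>0$ on $K$ and $\sup_K|\mathcal O^t_k|\le\varepsilon$. If $L^t_k\to0$, and $\vartheta^t_k\to0$ uniformly on bounded sets, as $(t,k)\to(\infty,\infty)$ jointly, then the same holds for all sufficiently large $t$ and $k$ jointly. -/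

import Mathlib

open Set Filter Topology MeasureTheory
open scoped NNReal ENNReal

noncomputable section

/-- `γ` is a solution on `[0, ∞)` of the initial value problem `γ' = f(γ)`, `γ(0) = x`. -/
def IsForwardSolution {n : ℕ} (f : EuclideanSpace ℝ (Fin n) → EuclideanSpace ℝ (Fin n))
    (x : EuclideanSpace ℝ (Fin n)) (γ : ℝ → EuclideanSpace ℝ (Fin n)) : Prop :=
  γ 0 = x ∧ ∀ t : ℝ, 0 ≤ t → HasDerivWithinAt γ (f (γ t)) (Ici 0) t

/-- Every initial value problem for `f` has a solution on all of `[0, ∞)`. -/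
def ForwardComplete {n : ℕ} (f : EuclideanSpace ℝ (Fin n) → EuclideanSpace ℝ (Fin n)) : Prop :=
  ∀ x, ∃ γ, IsForwardSolution f x γ

open Classical in
/-- The forward flow map `φ(t, x)` of `f`; only its values at `t ≥ 0` are meaningful, and there it
is determined by `f` when `f` is locally Lipschitz and forward complete. -/
def flowMap {n : ℕ} (f : EuclideanSpace ℝ (Fin n) → EuclideanSpace ℝ (Fin n)) (t : ℝ)
    (x : EuclideanSpace ℝ (Fin n)) : EuclideanSpace ℝ (Fin n) :=
  if hx : ∃ γ, IsForwardSolution f x γ then hx.choose t else x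

/-- Local exponential stability of the point `xeq`. -/
def LocallyExponentiallyStable {n : ℕ}
    (f : EuclideanSpace ℝ (Fin n) → EuclideanSpace ℝ (Fin n))
    (xeq : EuclideanSpace ℝ (Fin n)) : Prop :=
  ∃ δ > (0 : ℝ), ∃ M > (0 : ℝ), ∃ c > (0 : ℝ), ∀ x, ‖x - xeq‖ ≤ δ → ∀ t : ℝ, 0 ≤ t →
    ‖flowMap f t x - xeq‖ ≤ M * ‖x - xeq‖ * Real.exp (-(c * t))

/-- The region of attraction of `xeq`. -/
def regionOfAttraction {n : ℕ} (f : EuclideanSpace ℝ (Fin n) → EuclideanSpace ℝ (Fin n))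
    (xeq : EuclideanSpace ℝ (Fin n)) : Set (EuclideanSpace ℝ (Fin n)) :=
  {x | Tendsto (fun t : ℝ => flowMap f t x) atTop (𝓝 xeq)}

/-- `T_t h(x) = exp(-∫₀ᵗ η(φ(r, x)) dr) h(φ(t, x))`. -/
def zubovKoopman {n : ℕ} (f : EuclideanSpace ℝ (Fin n) → EuclideanSpace ℝ (Fin n))
    (η : EuclideanSpace ℝ (Fin n) → ℝ) (t : ℝ) (h : EuclideanSpace ℝ (Fin n) → ℝ)
    (x : EuclideanSpace ℝ (Fin n)) : ℝ :=
  Real.exp (-∫ r in (0 : ℝ)..t, η (flowMap f r x)) * h (flowMap f t x)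

/-- `V(x) = ∫₀^∞ η(φ(t, x)) dt ∈ [0, ∞]` for nonnegative `η`. -/
def zubovV {n : ℕ} (f : EuclideanSpace ℝ (Fin n) → EuclideanSpace ℝ (Fin n))
    (η : EuclideanSpace ℝ (Fin n) → ℝ) (x : EuclideanSpace ℝ (Fin n)) : ℝ≥0∞ :=
  ∫⁻ t in Ici (0 : ℝ), ENNReal.ofReal (η (flowMap f t x))

open Classical in
/-- `U_h(x) = exp(-V(x)) h(lim_{t → ∞} φ(t, x))` if `V(x) < ∞`, and `U_h(x) = 0` otherwise. -/
def zubovU {n : ℕ} (f : EuclideanSpace ℝ (Fin n) → EuclideanSpace ℝ (Fin n))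
    (η : EuclideanSpace ℝ (Fin n) → ℝ) (h : EuclideanSpace ℝ (Fin n) → ℝ)
    (x : EuclideanSpace ℝ (Fin n)) : ℝ :=
  if zubovV f η x < ∞ then
    Real.exp (-(zubovV f η x).toReal) * h (limUnder atTop fun t : ℝ => flowMap f t x)
  else 0

/-- The superdifferential `∂⁺v(x)`, as a set of covectors: those `p` for which
`limsup_{y → x} (v(y) - v(x) - p(y - x)) / |y - x| ≤ 0`. -/
def superdifferential {X : Type*} [NormedAddCommGroup X] [NormedSpace ℝ X] (v : X → ℝ) (x : X) :
    Set (X →L[ℝ] ℝ) :=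
  {p | ∀ ε > (0 : ℝ), ∀ᶠ y in 𝓝 x, v y - v x - p (y - x) ≤ ε * ‖y - x‖}

/-- The subdifferential `∂⁻v(x)`, as a set of covectors: those `q` for which
`liminf_{y → x} (v(y) - v(x) - q(y - x)) / |y - x| ≥ 0`. -/
def subdifferential {X : Type*} [NormedAddCommGroup X] [NormedSpace ℝ X] (v : X → ℝ) (x : X) :
    Set (X →L[ℝ] ℝ) :=
  {q | ∀ ε > (0 : ℝ), ∀ᶠ y in 𝓝 x, -(ε * ‖y - x‖) ≤ v y - v x - q (y - x)}

/-- `v` is a (continuous) viscosity solution of `F(x, v(x), ∇v(x)) = 0` on the open set `Ω`. -/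
def IsViscositySolutionOn {X : Type*} [NormedAddCommGroup X] [NormedSpace ℝ X]
    (F : X → ℝ → (X →L[ℝ] ℝ) → ℝ) (Ω : Set X) (v : X → ℝ) : Prop :=
  ContinuousOn v Ω ∧
  (∀ x ∈ Ω, ∀ p ∈ superdifferential v x, F x (v x) p ≤ 0) ∧
  (∀ x ∈ Ω, ∀ q ∈ subdifferential v x, 0 ≤ F x (v x) q)

/-- The function `∂ₜu - ∇ₓu · f(x) + η(x) u` of `((t, x), u, (∂ₜu, ∇ₓu))`. -/
def feynmanKacHamiltonian {n : ℕ} (f : EuclideanSpace ℝ (Fin n) → EuclideanSpace ℝ (Fin n))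
    (η : EuclideanSpace ℝ (Fin n) → ℝ) (z : ℝ × EuclideanSpace ℝ (Fin n)) (r : ℝ)
    (p : ℝ × EuclideanSpace ℝ (Fin n) →L[ℝ] ℝ) : ℝ :=
  p (1, 0) - p (0, f z.2) + η z.2 * r

/-- `u` is a viscosity solution of the Cauchy problem `∂ₜu = ∇ₓu · f - η u` for `t > 0`,
`u(0, ·) = h`, continuous up to `t = 0`. -/
def IsFeynmanKacSolution {n : ℕ} (f : EuclideanSpace ℝ (Fin n) → EuclideanSpace ℝ (Fin n))
    (η h : EuclideanSpace ℝ (Fin n) → ℝ) (u : ℝ × EuclideanSpace ℝ (Fin n) → ℝ) : Prop :=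
  ContinuousOn u (Ici 0 ×ˢ univ) ∧
  IsViscositySolutionOn (feynmanKacHamiltonian f η) (Ioi 0 ×ˢ univ) u ∧
  ∀ x, u (0, x) = h x

/-- The function `-∇v · f(x) - η(x) + O(x)` of the perturbed Lyapunov equation. -/
def lyapunovHamiltonian {n : ℕ} (f : EuclideanSpace ℝ (Fin n) → EuclideanSpace ℝ (Fin n))
    (η O : EuclideanSpace ℝ (Fin n) → ℝ) (x : EuclideanSpace ℝ (Fin n)) (_r : ℝ)
    (p : EuclideanSpace ℝ (Fin n) →L[ℝ] ℝ) : ℝ :=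
  -(p (f x)) - η x + O x

/-- Along `l`, the family `θ` tends to `0` uniformly on every bounded set. -/
def VanishesOnBoundedSets {ι : Type*} {n : ℕ} (l : Filter ι)
    (θ : ι → EuclideanSpace ℝ (Fin n) → ℝ) : Prop :=
  ∀ Ω : Set (EuclideanSpace ℝ (Fin n)), Bornology.IsBounded Ω →
    TendstoUniformlyOn θ (fun _ => 0) l Ω

end

/-!
Everything is read off along trajectories, where the weighted semigroup satisfies
`T_{s+t} h (x) = exp (-∫₀ˢ η(φ(r, x)) dr) · T_t h (φ(s, x))` (`zubovKoopman_add`).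

*Viscosity inequalities along curves.* If a curve leaves a point `x` with right velocity `b`, a
supergradient `p` at `x` bounds the upper Dini derivative along the curve by `p b`, and a
subgradient bounds the lower one from below. Hence `T_t h`, which is differentiable along
characteristics, solves the Cauchy problem. Conversely, a merely continuous `w` whose
supergradients all satisfy `g ≤ p b` grows along integral curves of `b` at least as fast as the
integral of `g` (`integral_le_sub_of_superdifferential`): its sup-convolutions have this property
up to a small error, because the gradient of the penalty at a maximizer is a supergradient of `w`
there. This yields uniqueness for the Cauchy problem, and for the perturbed Lyapunov equation when
the perturbation is continuous.

*Convergence.* If `η` is bounded below away from the equilibrium, a trajectory either enters a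
small ball around it before a time `T` that does not depend on the starting point, and then
`T_t h` is almost stationary, or it accumulates so much cost that both `T_t h` and `U_h` are small.
So `T_t h → U_h` uniformly on the whole space
(`exists_forall_abs_zubovKoopman_sub_zubovU_le`), and the residual accounts for the rest.

*The perturbed Lyapunov equation.* The perturbation `O` is `η` plus the upper right Dini derivative
of `v = -log u` along the flow. It lies between the values prescribed by subgradients and by
supergradients, so `v` is a viscosity solution whatever `O` looks like. Two locally Lipschitz
solutions are differentiable almost everywhere by Rademacher's theorem and have there the same
derivative along `f`; since the flow has a locally Lipschitz inverse, it pulls null sets back to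
null sets, and by Fubini's theorem the difference is constant along almost every trajectory
(`LocallyLipschitzOn.comp_flowMap_eq`), hence along all of them, with value its value at the
equilibrium. Finally, with `u = T_t h - θ` and `z = φ(t, x)`, the semigroup identity bounds `|O(x)|`
by the terms `η(x) θ(x)`, `η(z) T_t h(x)`, `‖f z‖` times the Lipschitz constant of `h` near the
equilibrium and `‖f x‖` times that of `θ`, all divided by `u(x)`. On compact subsets of the region
of attraction `u` is bounded below and `z` tends uniformly to the equilibrium, so these terms
vanish (`exists_forall_abs_add_flowDini_le`).
-/

/-! ### The forward flow -/

section Flow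

variable {n : ℕ} {f : EuclideanSpace ℝ (Fin n) → EuclideanSpace ℝ (Fin n)}
  {x y : EuclideanSpace ℝ (Fin n)} {γ γ' : ℝ → EuclideanSpace ℝ (Fin n)}

theorem IsForwardSolution.continuousOn (h : IsForwardSolution f x γ) :
    ContinuousOn γ (Ici 0) :=
  fun t ht => (h.2 t ht).continuousWithinAt

theorem IsForwardSolution.hasDerivWithinAt_Ici (h : IsForwardSolution f x γ) {t : ℝ}
    (ht : 0 ≤ t) : HasDerivWithinAt γ (f (γ t)) (Ici t) t :=
  (h.2 t ht).mono (Ici_subset_Ici.2 ht)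

theorem IsForwardSolution.hasDerivAt (h : IsForwardSolution f x γ) {t : ℝ} (ht : 0 < t) :
    HasDerivAt γ (f (γ t)) t :=
  (h.2 t ht.le).hasDerivAt (Ici_mem_nhds ht)

theorem IsForwardSolution.comp_add_left (h : IsForwardSolution f x γ) {s : ℝ} (hs : 0 ≤ s) :
    IsForwardSolution f (γ s) (fun t => γ (s + t)) := by
  refine ⟨by simp, fun t ht => ?_⟩
  have h1 := h.2 (s + t) (by positivity)
  have h2 : HasDerivWithinAt (fun t : ℝ => s + t) 1 (Ici 0) t :=
    ((hasDerivAt_id t).const_add s).hasDerivWithinAt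
  simpa [Function.comp_def] using h1.scomp t h2 (fun r (hr : 0 ≤ r) => by
    simpa using add_nonneg hs hr)

/-- Forward Grönwall estimate. -/
theorem IsForwardSolution.dist_le (h : IsForwardSolution f x γ) (h' : IsForwardSolution f y γ')
    {N : Set (EuclideanSpace ℝ (Fin n))} {L : ℝ≥0} (hL : LipschitzOnWith L f N) {T : ℝ}
    (hN : ∀ t ∈ Icc 0 T, γ t ∈ N) (hN' : ∀ t ∈ Icc 0 T, γ' t ∈ N) :
    ∀ t ∈ Icc 0 T, dist (γ t) (γ' t) ≤ dist x y * Real.exp (L * t) := by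
  intro t ht
  have := dist_le_of_trajectories_ODE_of_mem (v := fun _ => f) (s := fun _ => N) (K := L)
    (f := γ) (g := γ') (a := 0) (b := T) (δ := dist x y) (fun _ _ => hL)
    (h.continuousOn.mono Icc_subset_Ici_self) (fun s hs => h.hasDerivWithinAt_Ici hs.1)
    (fun s hs => hN s ⟨hs.1, hs.2.le⟩)
    (h'.continuousOn.mono Icc_subset_Ici_self) (fun s hs => h'.hasDerivWithinAt_Ici hs.1)
    (fun s hs => hN' s ⟨hs.1, hs.2.le⟩) (by rw [h.1, h'.1]) t ht
  simpa using this

/-- Backward Grönwall estimate: the flow does not contract distances faster than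
exponentially. -/
theorem IsForwardSolution.dist_le_backward (h : IsForwardSolution f x γ)
    (h' : IsForwardSolution f y γ')
    {N : Set (EuclideanSpace ℝ (Fin n))} {L : ℝ≥0} (hL : LipschitzOnWith L f N) {T : ℝ}
    (hT : 0 ≤ T) (hN : ∀ t ∈ Icc 0 T, γ t ∈ N) (hN' : ∀ t ∈ Icc 0 T, γ' t ∈ N) :
    dist x y ≤ dist (γ T) (γ' T) * Real.exp (L * T) := by
  have key : ∀ {z : EuclideanSpace ℝ (Fin n)} {ζ : ℝ → EuclideanSpace ℝ (Fin n)},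
      IsForwardSolution f z ζ → ContinuousOn (fun r => ζ (T - r)) (Icc 0 T) ∧
        ∀ r ∈ Ico 0 T, HasDerivWithinAt (fun r => ζ (T - r)) (-f (ζ (T - r))) (Ici r) r := by
    intro z ζ hζ
    refine ⟨hζ.continuousOn.comp (by fun_prop) fun r hr => sub_nonneg.2 hr.2, fun r hr => ?_⟩
    have h1 := (hζ.hasDerivAt (t := T - r) (sub_pos.2 hr.2)).scomp r
      ((hasDerivAt_id r).const_sub T)
    simpa [Function.comp_def] using h1.hasDerivWithinAt
  have := dist_le_of_trajectories_ODE_of_mem (v := fun _ => fun z => -f z) (s := fun _ => N)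
    (K := L) (f := fun r => γ (T - r)) (g := fun r => γ' (T - r)) (a := 0) (b := T)
    (δ := dist (γ T) (γ' T)) (fun _ _ => hL.neg) (key h).1 (key h).2
    (fun s hs => hN _ ⟨by linarith [hs.2], by linarith [hs.1]⟩) (key h').1 (key h').2
    (fun s hs => hN' _ ⟨by linarith [hs.2], by linarith [hs.1]⟩) (by simp) T ⟨hT, le_rfl⟩
  simpa [h.1, h'.1] using this

/-- A solution starting close enough to another one stays within distance `1` of it. -/
theorem IsForwardSolution.dist_lt_one (h : IsForwardSolution f x γ)
    (h' : IsForwardSolution f y γ') {T : ℝ} {L : ℝ≥0}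
    (hL : LipschitzOnWith L f (Metric.cthickening 1 (γ '' Icc 0 T)))
    (hd : dist x y * Real.exp (L * T) < 1) :
    ∀ t ∈ Icc 0 T, dist (γ t) (γ' t) < 1 := by
  by_contra! hcon
  obtain ⟨t₁, ht₁, hfar⟩ := hcon
  -- the first time at which the distance reaches `1`
  set S : Set ℝ := {t | t ∈ Icc 0 T ∧ 1 ≤ dist (γ t) (γ' t)} with hS
  have hScl : IsClosed S :=
    ContinuousOn.preimage_isClosed_of_isClosed
      (f := fun t => dist (γ t) (γ' t))
      (continuous_dist.comp_continuousOn ((h.continuousOn.mono Icc_subset_Ici_self).prodMk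
        (h'.continuousOn.mono Icc_subset_Ici_self)))
      isClosed_Icc isClosed_Ici
  have hbdd : BddBelow S := ⟨0, fun t ht => ht.1.1⟩
  have hmem : sInf S ∈ S := hScl.csInf_mem ⟨t₁, ht₁, hfar⟩ hbdd
  set τ := sInf S
  have hbefore : ∀ t ∈ Ico 0 τ, dist (γ t) (γ' t) < 1 := by
    intro t ht
    by_contra! hge
    exact absurd (csInf_le hbdd (show t ∈ S from ⟨⟨ht.1, ht.2.le.trans hmem.1.2⟩, hge⟩))
      (not_le.2 ht.2)
  have hmemN : ∀ t ∈ Icc 0 T, ∀ z, dist (γ t) z ≤ 1 →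
      z ∈ Metric.cthickening 1 (γ '' Icc 0 T) := fun t ht z hz =>
    Metric.mem_cthickening_of_dist_le z (γ t) 1 _ (mem_image_of_mem _ ht) (by rwa [dist_comm])
  have hle := dist_le_of_trajectories_ODE_of_mem (v := fun _ => f)
    (s := fun _ => Metric.cthickening 1 (γ '' Icc 0 T)) (K := L)
    (f := γ) (g := γ') (a := 0) (b := τ) (δ := dist x y) (fun _ _ => hL)
    (h.continuousOn.mono Icc_subset_Ici_self) (fun s hs => h.hasDerivWithinAt_Ici hs.1)
    (fun s hs => hmemN s ⟨hs.1, hs.2.le.trans hmem.1.2⟩ _ (by simp))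
    (h'.continuousOn.mono Icc_subset_Ici_self) (fun s hs => h'.hasDerivWithinAt_Ici hs.1)
    (fun s hs => hmemN s ⟨hs.1, hs.2.le.trans hmem.1.2⟩ _ (hbefore s hs).le)
    (by rw [h.1, h'.1]) τ ⟨hmem.1.1, le_rfl⟩
  have : dist x y * Real.exp (L * (τ - 0)) ≤ dist x y * Real.exp (L * T) := by
    gcongr
    simpa using hmem.1.2
  linarith [hmem.2]

theorem LocallyLipschitz.exists_lipschitzOnWith_of_isCompact {α β : Type*} [PseudoMetricSpace α]
    [PseudoMetricSpace β] {g : α → β} (hg : LocallyLipschitz g)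
    {K : Set α} (hK : IsCompact K) : ∃ L : ℝ≥0, LipschitzOnWith L g K :=
  LocallyLipschitzOn.exists_lipschitzOnWith_of_compact hK hg.locallyLipschitzOn

theorem IsForwardSolution.isCompact_cthickening (h : IsForwardSolution f x γ) (T : ℝ) :
    IsCompact (Metric.cthickening 1 (γ '' Icc 0 T)) :=
  (isCompact_Icc.image_of_continuousOn (h.continuousOn.mono Icc_subset_Ici_self)).cthickening

theorem IsForwardSolution.eq (hf : LocallyLipschitz f) (h : IsForwardSolution f x γ)
    (h' : IsForwardSolution f x γ') {t : ℝ} (ht : 0 ≤ t) : γ t = γ' t := by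
  have hK : IsCompact (γ '' Icc 0 t ∪ γ' '' Icc 0 t) :=
    (isCompact_Icc.image_of_continuousOn (h.continuousOn.mono Icc_subset_Ici_self)).union
      (isCompact_Icc.image_of_continuousOn (h'.continuousOn.mono Icc_subset_Ici_self))
  obtain ⟨L, hL⟩ := hf.exists_lipschitzOnWith_of_isCompact hK
  have := h.dist_le h' hL (fun s hs => Or.inl (mem_image_of_mem _ hs))
    (fun s hs => Or.inr (mem_image_of_mem _ hs)) t ⟨ht, le_rfl⟩
  rw [dist_self, zero_mul] at this
  exact dist_le_zero.1 this

theorem isForwardSolution_flowMap (hc : ForwardComplete f) (x : EuclideanSpace ℝ (Fin n)) :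
    IsForwardSolution f x (fun t => flowMap f t x) := by
  have hx : ∃ γ, IsForwardSolution f x γ := hc x
  simp only [flowMap, dif_pos hx]
  exact hx.choose_spec

theorem flowMap_zero (hc : ForwardComplete f) (x : EuclideanSpace ℝ (Fin n)) :
    flowMap f 0 x = x := (isForwardSolution_flowMap hc x).1

theorem flowMap_add (hf : LocallyLipschitz f) (hc : ForwardComplete f) {s t : ℝ} (hs : 0 ≤ s)
    (ht : 0 ≤ t) (x : EuclideanSpace ℝ (Fin n)) :
    flowMap f (s + t) x = flowMap f t (flowMap f s x) :=
  ((isForwardSolution_flowMap hc x).comp_add_left hs).eq hf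
    (isForwardSolution_flowMap hc (flowMap f s x)) ht

theorem flowMap_of_eq_zero (hf : LocallyLipschitz f) (hc : ForwardComplete f) (hx : f x = 0)
    {t : ℝ} (ht : 0 ≤ t) : flowMap f t x = x := by
  have : IsForwardSolution f x (fun _ => x) :=
    ⟨rfl, fun t _ => by simpa [hx] using hasDerivWithinAt_const t (Ici 0) x⟩
  exact (isForwardSolution_flowMap hc x).eq hf this ht

/-- Trajectories over a bounded time interval that start near a given point stay in a common
compact set. -/
theorem exists_flowMap_mem_of_isCompact (hf : LocallyLipschitz f) (hc : ForwardComplete f)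
    (x₀ : EuclideanSpace ℝ (Fin n)) (T : ℝ) :
    ∃ δ > (0 : ℝ), ∃ N : Set (EuclideanSpace ℝ (Fin n)), IsCompact N ∧ ∃ L : ℝ≥0,
      LipschitzOnWith L f N ∧ ∀ x ∈ Metric.ball x₀ δ, ∀ t ∈ Icc 0 T, flowMap f t x ∈ N := by
  have h₀ := isForwardSolution_flowMap hc x₀
  have hN := h₀.isCompact_cthickening T
  obtain ⟨L, hL⟩ := hf.exists_lipschitzOnWith_of_isCompact hN
  refine ⟨Real.exp (-(L * T)), Real.exp_pos _, _, hN, L, hL, fun x hx t ht => ?_⟩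
  have hd : dist x₀ x * Real.exp (L * T) < 1 := by
    have := mul_lt_mul_of_pos_right (Metric.mem_ball'.1 hx) (Real.exp_pos (L * T))
    rwa [← Real.exp_add, neg_add_cancel, Real.exp_zero] at this
  have := h₀.dist_lt_one (isForwardSolution_flowMap hc x) hL hd t ht
  exact Metric.mem_cthickening_of_dist_le _ _ 1 _ (mem_image_of_mem _ ht)
    (by rw [dist_comm]; exact this.le)

theorem continuousOn_flowMap_left (hc : ForwardComplete f) (x : EuclideanSpace ℝ (Fin n)) :
    ContinuousOn (fun t => flowMap f t x) (Ici 0) :=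
  (isForwardSolution_flowMap hc x).continuousOn

/-- Joint continuity of the flow. Negative times are cut off, since the flow map carries no
information there. -/
theorem continuous_flowMap_max (hf : LocallyLipschitz f) (hc : ForwardComplete f) :
    Continuous fun z : ℝ × EuclideanSpace ℝ (Fin n) => flowMap f (max z.1 0) z.2 := by
  rw [continuous_iff_continuousAt]
  rintro ⟨t₀, x₀⟩
  obtain ⟨δ, hδ, N, -, L, hL, hN⟩ := exists_flowMap_mem_of_isCompact hf hc x₀ (max t₀ 0 + 1)
  have hcont : Continuous fun t : ℝ => flowMap f (max t 0) x₀ :=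
    (continuousOn_flowMap_left hc x₀).comp_continuous (by fun_prop)
      fun t => mem_Ici.2 (le_max_right _ _)
  rw [ContinuousAt, tendsto_iff_dist_tendsto_zero]
  refine squeeze_zero' (Eventually.of_forall fun _ => dist_nonneg)
    (g := fun z : ℝ × EuclideanSpace ℝ (Fin n) =>
      dist z.2 x₀ * Real.exp (L * (max t₀ 0 + 1)) +
        dist (flowMap f (max z.1 0) x₀) (flowMap f (max t₀ 0) x₀)) ?_ ?_
  · have hev : ∀ᶠ z : ℝ × EuclideanSpace ℝ (Fin n) in 𝓝 (t₀, x₀),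
        z.1 < t₀ + 1 ∧ z.2 ∈ Metric.ball x₀ δ :=
      ((continuous_fst.tendsto (t₀, x₀)).eventually (gt_mem_nhds (lt_add_one t₀))).and
        ((continuous_snd.tendsto (t₀, x₀)).eventually (Metric.ball_mem_nhds x₀ hδ))
    filter_upwards [hev] with z hz
    have hz1 : max z.1 0 ∈ Icc 0 (max t₀ 0 + 1) :=
      ⟨le_max_right _ _, max_le (by linarith [hz.1, le_max_left t₀ 0])
        (by linarith [le_max_right t₀ 0])⟩
    have h1 := (isForwardSolution_flowMap hc z.2).dist_le (isForwardSolution_flowMap hc x₀) hL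
      (hN _ hz.2) (hN _ (Metric.mem_ball_self hδ)) _ hz1
    have h2 : dist z.2 x₀ * Real.exp (L * max z.1 0) ≤
        dist z.2 x₀ * Real.exp (L * (max t₀ 0 + 1)) := by
      gcongr
      exact hz1.2
    linarith [dist_triangle (flowMap f (max z.1 0) z.2) (flowMap f (max z.1 0) x₀)
      (flowMap f (max t₀ 0) x₀)]
  · have : Continuous fun z : ℝ × EuclideanSpace ℝ (Fin n) =>
        dist z.2 x₀ * Real.exp (L * (max t₀ 0 + 1)) +
          dist (flowMap f (max z.1 0) x₀) (flowMap f (max t₀ 0) x₀) := by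
      have := hcont.comp (continuous_fst (X := ℝ) (Y := EuclideanSpace ℝ (Fin n)))
      simp only [Function.comp_def] at this
      fun_prop
    simpa using this.tendsto (t₀, x₀)

theorem continuousOn_flowMap (hf : LocallyLipschitz f) (hc : ForwardComplete f) :
    ContinuousOn (fun z : ℝ × EuclideanSpace ℝ (Fin n) => flowMap f z.1 z.2)
      (Ici 0 ×ˢ univ) :=
  (continuous_flowMap_max hf hc).continuousOn.congr fun z hz => by
    simp [max_eq_left (show (0 : ℝ) ≤ z.1 from hz.1)]

theorem continuous_flowMap_right (hf : LocallyLipschitz f) (hc : ForwardComplete f) {t : ℝ}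
    (ht : 0 ≤ t) : Continuous (flowMap f t) := by
  have := (continuous_flowMap_max hf hc).comp (Continuous.prodMk_right t)
  simpa [Function.comp_def, max_eq_left ht] using this

end Flow

/-! ### Viscosity inequalities along integral curves -/

section Viscosity

variable {X : Type*} [NormedAddCommGroup X] [NormedSpace ℝ X]

theorem neg_mem_superdifferential_neg {v : X → ℝ} {x : X} {q : X →L[ℝ] ℝ}
    (hq : q ∈ subdifferential v x) : -q ∈ superdifferential (fun y => -v y) x := by
  intro ε hε
  filter_upwards [hq ε hε] with y hy
  simp only [_root_.neg_apply]
  linarith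

theorem neg_mem_subdifferential_of_neg {v : X → ℝ} {x : X} {p : X →L[ℝ] ℝ}
    (hp : p ∈ superdifferential (fun y => -v y) x) : -p ∈ subdifferential v x := by
  intro ε hε
  filter_upwards [hp ε hε] with y hy
  simp only [_root_.neg_apply]
  linarith

theorem HasFDerivAt.mem_superdifferential {v : X → ℝ} {x : X} {p : X →L[ℝ] ℝ}
    (h : HasFDerivAt v p x) : p ∈ superdifferential v x := by
  intro ε hε
  filter_upwards [h.isLittleO.def hε] with y hy
  exact (le_abs_self _).trans hy

theorem HasFDerivAt.mem_subdifferential {v : X → ℝ} {x : X} {p : X →L[ℝ] ℝ}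
    (h : HasFDerivAt v p x) : p ∈ subdifferential v x := by
  intro ε hε
  filter_upwards [h.isLittleO.def hε] with y hy
  exact neg_le_of_abs_le hy

theorem mem_superdifferential_of_isLocalMax {v ψ : X → ℝ} {x : X} {p : X →L[ℝ] ℝ}
    (hψ : HasFDerivAt ψ p x) (hmax : IsLocalMax (fun y => v y - ψ y) x) :
    p ∈ superdifferential v x := by
  intro ε hε
  filter_upwards [hψ.mem_superdifferential ε hε, hmax] with y hy hy'
  linarith

/-- A supergradient bounds from above the growth along a curve that leaves the point with a
given right velocity. -/
theorem eventually_slope_le_of_mem_superdifferential {v : X → ℝ} {x : X} {p : X →L[ℝ] ℝ}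
    (hp : p ∈ superdifferential v x) {y : ℝ → X} {b : X} (hy0 : y 0 = x)
    (hy : HasDerivWithinAt y b (Ici 0) 0) {ε : ℝ} (hε : 0 < ε) :
    ∀ᶠ s in 𝓝[>] (0 : ℝ), (v (y s) - v x) / s ≤ p b + ε := by
  have hslope : Tendsto (fun s : ℝ => s⁻¹ • (y s - x)) (𝓝[>] 0) (𝓝 b) := by
    have := (hasDerivWithinAt_iff_tendsto_slope' (self_notMem_Ioi)).1
      (hy.mono Ioi_subset_Ici_self)
    simpa [slope_fun_def, hy0] using this
  set ε₁ : ℝ := ε / (2 * (‖b‖ + 1)) with hε₁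
  have hb : 0 < ‖b‖ + 1 := by positivity
  have hε₁pos : 0 < ε₁ := by positivity
  have hlim : Tendsto (fun s : ℝ => p (s⁻¹ • (y s - x)) + ε₁ * ‖s⁻¹ • (y s - x)‖) (𝓝[>] 0)
      (𝓝 (p b + ε₁ * ‖b‖)) :=
    ((p.continuous.tendsto b).comp hslope).add ((hslope.norm).const_mul ε₁)
  have hlt : p b + ε₁ * ‖b‖ < p b + ε := by
    have : ε₁ * (2 * (‖b‖ + 1)) = ε := by rw [hε₁]; field_simp
    nlinarith [norm_nonneg b]
  have hcont : Tendsto y (𝓝[>] 0) (𝓝 x) := by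
    have := (hy.mono Ioi_subset_Ici_self).continuousWithinAt
    rwa [ContinuousWithinAt, hy0] at this
  filter_upwards [hlim.eventually (gt_mem_nhds hlt), hcont.eventually (hp ε₁ hε₁pos),
    self_mem_nhdsWithin] with s hs1 hs2 (hs : 0 < s)
  refine le_trans ?_ hs1.le
  rw [map_smul, norm_smul, norm_inv, Real.norm_of_nonneg hs.le, smul_eq_mul, div_le_iff₀ hs]
  have : (s⁻¹ * p (y s - x) + ε₁ * (s⁻¹ * ‖y s - x‖)) * s
      = p (y s - x) + ε₁ * ‖y s - x‖ := by field_simp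
  linarith

theorem eventually_le_slope_of_mem_subdifferential {v : X → ℝ} {x : X} {q : X →L[ℝ] ℝ}
    (hq : q ∈ subdifferential v x) {y : ℝ → X} {b : X} (hy0 : y 0 = x)
    (hy : HasDerivWithinAt y b (Ici 0) 0) {ε : ℝ} (hε : 0 < ε) :
    ∀ᶠ s in 𝓝[>] (0 : ℝ), q b - ε ≤ (v (y s) - v x) / s := by
  filter_upwards [eventually_slope_le_of_mem_superdifferential
    (neg_mem_superdifferential_neg hq) hy0 hy hε] with s hs
  have : (-v (y s) - -v x) / s = -((v (y s) - v x) / s) := by ring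
  rw [this, _root_.neg_apply] at hs
  linarith

variable [FiniteDimensional ℝ X]

/-- The quadratic penalty centred at `c`, differentiated in the variable `y`. -/
theorem hasFDerivAt_penalty (κ : ℝ) (c y : X) :
    HasFDerivAt (fun y => κ * ‖toEuclidean (c - y)‖ ^ 2)
      (κ • (2 • (innerSL ℝ (toEuclidean (c - y))).comp
        ((toEuclidean (E := X) :
          X →L[ℝ] EuclideanSpace ℝ (Fin (Module.finrank ℝ X))).comp
            (-ContinuousLinearMap.id ℝ X)))) y := by
  have h1 : HasFDerivAt (fun y : X => toEuclidean (c - y))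
      ((toEuclidean (E := X) :
          X →L[ℝ] EuclideanSpace ℝ (Fin (Module.finrank ℝ X))).comp
            (-ContinuousLinearMap.id ℝ X)) y :=
    (toEuclidean (E := X)).hasFDerivAt.comp y ((hasFDerivAt_id y).const_sub c)
  exact h1.norm_sq.const_mul κ

/-- If every supergradient `p` of the continuous function `w` satisfies `g ≤ p b`, for a locally
Lipschitz vector field `b` and a continuous `g`, then `w` grows along integral curves of `b` at
least as fast as the integral of `g`. The sup-convolutions
`m(s) = max_y (w y - κ |γ s - y|²)` have lower right Dini derivative at least `g (γ s)` up to an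
error that vanishes as `κ → ∞`, because the penalty gradient at a maximizer is a supergradient
of `w` there. -/
theorem integral_le_sub_of_superdifferential {Ω : Set X} (hΩ : IsOpen Ω) {b : X → X}
    (hb : LocallyLipschitz b) {w g : X → ℝ} (hw : ContinuousOn w Ω) (hg : ContinuousOn g Ω)
    (hsub : ∀ x ∈ Ω, ∀ p ∈ superdifferential w x, g x ≤ p (b x))
    {γ : ℝ → X} {S : ℝ} (hS : 0 ≤ S) (hγc : ContinuousOn γ (Icc 0 S))
    (hγ : ∀ s ∈ Ico 0 S, HasDerivWithinAt γ (b (γ s)) (Ici s) s)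
    (hγΩ : ∀ s ∈ Icc 0 S, γ s ∈ Ω) :
    ∫ s in (0 : ℝ)..S, g (γ s) ≤ w (γ S) - w (γ 0) := by
  have hΓ : IsCompact (γ '' Icc 0 S) := isCompact_Icc.image_of_continuousOn hγc
  obtain ⟨δ, hδ, hδΩ⟩ := hΓ.exists_cthickening_subset_open hΩ (image_subset_iff.2 hγΩ)
  set K := Metric.cthickening δ (γ '' Icc 0 S) with hKdef
  have hK : IsCompact K := hΓ.cthickening
  have hwK := hw.mono hδΩ
  have hgK := hg.mono hδΩ
  have hγK : ∀ s ∈ Icc 0 S, γ s ∈ K := fun s hs =>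
    Metric.self_subset_cthickening _ (mem_image_of_mem _ hs)
  obtain ⟨L, hL⟩ := hb.exists_lipschitzOnWith_of_isCompact hK
  obtain ⟨C, hC⟩ := hK.exists_bound_of_continuousOn hwK
  have hC0 : 0 ≤ C := (norm_nonneg _).trans (hC _ (hγK 0 ⟨le_rfl, hS⟩))
  set e : X ≃L[ℝ] _ := toEuclidean (E := X) with he
  set A : ℝ := ‖(e.symm : EuclideanSpace ℝ (Fin (Module.finrank ℝ X)) →L[ℝ] X)‖ with hA
  set B : ℝ := ‖(e : X →L[ℝ] EuclideanSpace ℝ (Fin (Module.finrank ℝ X)))‖ with hB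
  have hA0 : 0 ≤ A := norm_nonneg _
  have hB0 : 0 ≤ B := norm_nonneg _
  have hAe : ∀ z : X, ‖z‖ ≤ A * ‖e z‖ := fun z => by
    simpa using (e.symm : EuclideanSpace ℝ (Fin (Module.finrank ℝ X)) →L[ℝ] X).le_opNorm (e z)
  have hBe : ∀ z : X, ‖e z‖ ≤ B * ‖z‖ := fun z =>
    (e : X →L[ℝ] EuclideanSpace ℝ (Fin (Module.finrank ℝ X))).le_opNorm z
  have hgγ : ContinuousOn (fun s => g (γ s)) (Icc 0 S) := hgK.comp hγc hγK
  have hgint : IntervalIntegrable (fun s => g (γ s)) volume 0 S :=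
    ContinuousOn.intervalIntegrable (by rwa [uIcc_of_le hS])
  set D : ℝ := 1 + 2 * B * L * A with hD
  -- it suffices to prove the inequality with an arbitrarily small error
  suffices hmain : ∀ ε > (0 : ℝ),
      ∫ s in (0 : ℝ)..S, g (γ s) ≤ w (γ S) - w (γ 0) + (1 + D * S) * ε by
    have hlim : Tendsto (fun ε : ℝ => w (γ S) - w (γ 0) + (1 + D * S) * ε) (𝓝[>] 0)
        (𝓝 (w (γ S) - w (γ 0))) := by
      have : Continuous fun ε : ℝ => w (γ S) - w (γ 0) + (1 + D * S) * ε := by fun_prop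
      simpa using (this.tendsto 0).mono_left nhdsWithin_le_nhds
    exact ge_of_tendsto hlim (by filter_upwards [self_mem_nhdsWithin] with ε hε using hmain ε hε)
  intro ε hε
  obtain ⟨ρ₁, hρ₁, hwρ⟩ :=
    Metric.uniformContinuousOn_iff.1 (hK.uniformContinuousOn_of_continuous hwK) ε hε
  obtain ⟨ρ₂, hρ₂, hgρ⟩ :=
    Metric.uniformContinuousOn_iff.1 (hK.uniformContinuousOn_of_continuous hgK) ε hε
  set ρ := min δ (min ρ₁ ρ₂) with hρ
  have hρ0 : 0 < ρ := by positivity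
  -- the penalty is so strong that maximizers are within `ρ` of the curve
  set κ : ℝ := (A ^ 2 * (2 * C) + 1) / ρ ^ 2 with hκ
  have hκ0 : 0 < κ := by positivity
  have hκρ : A ^ 2 * (2 * C) < κ * ρ ^ 2 := by
    rw [hκ, div_mul_cancel₀ _ (by positivity)]
    linarith
  set F : ℝ → X → ℝ := fun s y => w y - κ * ‖e (γ s - y)‖ ^ 2 with hF
  set m : ℝ → ℝ := fun s => sSup (F s '' K) with hm
  have hFc : ∀ s, ContinuousOn (F s) K := fun s =>
    hwK.sub (Continuous.continuousOn (by fun_prop))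
  have hbdd : ∀ s, BddAbove (F s '' K) := fun s => (hK.image_of_continuousOn (hFc s)).bddAbove
  have hle : ∀ s, ∀ y ∈ K, F s y ≤ m s := fun s y hy =>
    le_csSup (hbdd s) (mem_image_of_mem _ hy)
  have hmax : ∀ s, ∃ y ∈ K, m s = F s y := fun s => by
    obtain ⟨y, hy, hys⟩ := hK.exists_sSup_image_eq ⟨_, hγK 0 ⟨le_rfl, hS⟩⟩ (hFc s)
    exact ⟨y, hy, hys⟩
  have hmlow : ∀ s ∈ Icc 0 S, w (γ s) ≤ m s := fun s hs => by
    simpa [hF] using hle s _ (hγK s hs)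
  have hnear : ∀ s ∈ Icc 0 S, ∀ y ∈ K, m s = F s y →
      dist (γ s) y < ρ ∧ κ * ‖e (γ s - y)‖ ^ 2 ≤ ε ∧ m s ≤ w (γ s) + ε := by
    intro s hs y hy hys
    have h1 : κ * ‖e (γ s - y)‖ ^ 2 ≤ w y - w (γ s) := by
      have := hmlow s hs
      rw [hys] at this
      simp only [hF] at this
      linarith
    have h2 : w y - w (γ s) ≤ 2 * C := by
      have := abs_le.1 (hC y hy)
      have := abs_le.1 (hC _ (hγK s hs))
      linarith
    have h3 : dist (γ s) y < ρ := by
      rw [dist_eq_norm]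
      refine lt_of_pow_lt_pow_left₀ 2 hρ0.le ?_
      have h4 : ‖γ s - y‖ ^ 2 ≤ A ^ 2 * ‖e (γ s - y)‖ ^ 2 := by
        rw [← mul_pow]
        exact pow_le_pow_left₀ (norm_nonneg _) (hAe _) 2
      have h5 : κ * ‖γ s - y‖ ^ 2 < κ * ρ ^ 2 := by
        calc κ * ‖γ s - y‖ ^ 2 ≤ κ * (A ^ 2 * ‖e (γ s - y)‖ ^ 2) := by gcongr
          _ = A ^ 2 * (κ * ‖e (γ s - y)‖ ^ 2) := by ring
          _ ≤ A ^ 2 * (2 * C) := by gcongr A ^ 2 * ?_; linarith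
          _ < κ * ρ ^ 2 := hκρ
      exact lt_of_mul_lt_mul_left h5 hκ0.le
    have h6 : w y - w (γ s) ≤ ε := by
      have := hwρ y hy (γ s) (hγK s hs)
        (by rw [dist_comm]; exact h3.trans_le ((min_le_right _ _).trans (min_le_left _ _)))
      exact (le_abs_self _).trans (by rw [← Real.dist_eq]; exact this.le)
    refine ⟨h3, h1.trans h6, ?_⟩
    rw [hys]
    simp only [hF]
    have : 0 ≤ κ * ‖e (γ s - y)‖ ^ 2 := by positivity
    linarith
  have hmcont : ContinuousOn m (Icc 0 S) := by
    rw [continuousOn_iff_continuous_domRestrict]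
    have := isCompact_iff_compactSpace.1 hK
    have hcontF : Continuous
        ↿(fun (s : Icc (0 : ℝ) S) (y : K) => F s y) := by
      have hw' : Continuous fun y : K => w y := continuousOn_iff_continuous_domRestrict.1 hwK
      have hγ' : Continuous fun s : Icc (0 : ℝ) S => γ s :=
        continuousOn_iff_continuous_domRestrict.1 hγc
      have : Continuous fun z : Icc (0 : ℝ) S × K => w z.2 - κ * ‖e (γ z.1 - z.2)‖ ^ 2 := by
        have h1 := hw'.comp (continuous_snd (X := Icc (0 : ℝ) S))
        have h2 := hγ'.comp (continuous_fst (Y := K))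
        exact h1.sub (continuous_const.mul ((e.continuous.comp
          (h2.sub (continuous_subtype_val.comp continuous_snd))).norm.pow 2))
      exact this
    have := isCompact_univ.continuous_sSup hcontF
    refine this.congr fun s => ?_
    rw [image_univ]
    exact congrArg sSup (image_eq_range (F s) K).symm
  have hdini : ∀ s ∈ Ico 0 S, ∀ r, -(g (γ s) - D * ε) < r →
      ∃ᶠ z in 𝓝[>] s, slope (fun s => -m s) s z < r := by
    intro s hs r hr
    have hs' : s ∈ Icc 0 S := ⟨hs.1, hs.2.le⟩
    obtain ⟨y, hy, hys⟩ := hmax s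
    obtain ⟨hyρ, hyε, -⟩ := hnear s hs' y hy hys
    have hyK : K ∈ 𝓝 y := by
      refine mem_of_superset (Metric.isOpen_thickening.mem_nhds ?_)
        (Metric.thickening_subset_cthickening δ _)
      exact Metric.mem_thickening_iff.2
        ⟨γ s, mem_image_of_mem _ hs', by
          rw [dist_comm]; exact hyρ.trans_le (min_le_left _ _)⟩
    have hp := mem_superdifferential_of_isLocalMax (v := w) (hasFDerivAt_penalty κ (γ s) y) (by
      filter_upwards [hyK] with y' hy'
      have := hle s y' hy'
      rwa [hys] at this)
    have hgp := hsub y (hδΩ hy) _ hp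
    -- the velocity of the penalty along the curve
    set P : ℝ := κ * (2 * inner ℝ (e (γ s - y)) (e (b (γ s)))) with hP
    have hPbound : P ≤ -(g (γ s) - D * ε) := by
      have h1 : g y ≤ -(κ * (2 * inner ℝ (e (γ s - y)) (e (b y)))) := by
        refine hgp.trans (le_of_eq ?_)
        simp [he, -map_sub]
      have h2 : P - κ * (2 * inner ℝ (e (γ s - y)) (e (b y)))
          = κ * (2 * inner ℝ (e (γ s - y)) (e (b (γ s) - b y))) := by
        rw [hP, map_sub e (b (γ s)), inner_sub_right]
        ring
      have h3 : inner ℝ (e (γ s - y)) (e (b (γ s) - b y)) ≤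
          B * L * A * ‖e (γ s - y)‖ ^ 2 := by
        have h4 : ‖b (γ s) - b y‖ ≤ L * ‖γ s - y‖ := by
          simpa [dist_eq_norm] using hL.dist_le_mul _ (hγK s hs') _ hy
        calc inner ℝ (e (γ s - y)) (e (b (γ s) - b y))
            ≤ ‖e (γ s - y)‖ * ‖e (b (γ s) - b y)‖ := real_inner_le_norm _ _
          _ ≤ ‖e (γ s - y)‖ * (B * (L * (A * ‖e (γ s - y)‖))) := by
            gcongr
            refine (hBe _).trans ?_
            gcongr
            refine h4.trans ?_
            gcongr
            exact hAe _
          _ = B * L * A * ‖e (γ s - y)‖ ^ 2 := by ring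
      have h5 : κ * (2 * inner ℝ (e (γ s - y)) (e (b (γ s) - b y))) ≤ 2 * B * L * A * ε := by
        calc κ * (2 * inner ℝ (e (γ s - y)) (e (b (γ s) - b y)))
            ≤ κ * (2 * (B * L * A * ‖e (γ s - y)‖ ^ 2)) := by gcongr
          _ = 2 * B * L * A * (κ * ‖e (γ s - y)‖ ^ 2) := by ring
          _ ≤ 2 * B * L * A * ε := by gcongr
      have h6 : g (γ s) - g y ≤ ε := by
        have := hgρ (γ s) (hγK s hs') y hy
          (hyρ.trans_le ((min_le_right _ _).trans (min_le_right _ _)))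
        exact (le_abs_self _).trans (by rw [← Real.dist_eq]; exact this.le)
      have h7 : D * ε = ε + 2 * B * L * A * ε := by rw [hD]; ring
      linarith
    have hder : HasDerivWithinAt (fun s' => κ * ‖e (γ s' - y)‖ ^ 2) P (Ioi s) s := by
      have h1 : HasDerivWithinAt (fun s' => e (γ s' - y)) (e (b (γ s))) (Ioi s) s :=
        e.hasFDerivAt.comp_hasDerivWithinAt s
          (((hγ s hs).mono Ioi_subset_Ici_self).sub_const y)
      exact h1.norm_sq.const_mul κ
    have hslope := (hasDerivWithinAt_iff_tendsto_slope' self_notMem_Ioi).1 hder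
    have hev := hslope.eventually (gt_mem_nhds (hPbound.trans_lt hr))
    refine Eventually.frequently ?_
    filter_upwards [hev, self_mem_nhdsWithin] with z hz (hsz : s < z)
    refine lt_of_le_of_lt ?_ hz
    rw [slope_def_field, slope_def_field]
    have h1 := hle z y hy
    have hsz' : 0 < z - s := sub_pos.2 hsz
    rw [div_le_div_iff_of_pos_right hsz', hys]
    simp only [hF] at h1 ⊢
    linarith
  have hΦderiv : ∀ s ∈ Ico 0 S, HasDerivWithinAt
      (fun s => -m 0 - ((∫ r in (0 : ℝ)..s, g (γ r)) - D * ε * s)) (-(g (γ s) - D * ε))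
      (Ici s) s := by
    intro s hs
    have hcw : ContinuousWithinAt (fun s => g (γ s)) (Ioi s) s :=
      ((hgγ s ⟨hs.1, hs.2.le⟩).mono_of_mem_nhdsWithin (by
        filter_upwards [Ioo_mem_nhdsGT hs.2] with r hr using ⟨hs.1.trans hr.1.le, hr.2.le⟩))
    have hI := intervalIntegral.integral_hasDerivWithinAt_right (s := Ici s) (t := Ioi s)
      (hgint.mono_set (by
        rw [uIcc_of_le hs.1, uIcc_of_le hS]
        exact Icc_subset_Icc_right hs.2.le))
      (by
        refine ⟨Icc 0 S, ?_, hgγ.aestronglyMeasurable measurableSet_Icc⟩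
        filter_upwards [Ioo_mem_nhdsGT hs.2] with r hr using ⟨hs.1.trans hr.1.le, hr.2.le⟩)
      hcw
    have h2 : HasDerivWithinAt (fun s : ℝ => D * ε * s) (D * ε) (Ici s) s := by
      simpa using (hasDerivWithinAt_id s (Ici s)).const_mul (D * ε)
    exact (hI.sub h2).const_sub (-m 0)
  have hfence := image_le_of_liminf_slope_right_le_deriv_boundary
    (f := fun s => -m s) (a := 0) (b := S)
    (B := fun s => -m 0 - ((∫ r in (0 : ℝ)..s, g (γ r)) - D * ε * s))
    (B' := fun s => -(g (γ s) - D * ε)) hmcont.neg (by simp)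
    (by
      have := intervalIntegral.continuousOn_primitive_interval (a := 0) (b := S)
        (f := fun s => g (γ s)) (μ := volume) (by
          rw [uIcc_of_le hS]
          exact hgγ.integrableOn_Icc)
      rw [uIcc_of_le hS] at this
      fun_prop)
    hΦderiv hdini (right_mem_Icc.2 hS)
  obtain ⟨y, hy, hys⟩ := hmax S
  have hend := (hnear S (right_mem_Icc.2 hS) y hy hys).2.2
  have hstart := hmlow 0 (left_mem_Icc.2 hS)
  linarith

/-- The two-sided version of `integral_le_sub_of_superdifferential`: a continuous viscosity
solution of `∇w · b = g` with continuous `g` is differentiable along integral curves. -/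
theorem IsViscositySolutionOn.sub_eq_integral {Ω : Set X} (hΩ : IsOpen Ω) {b : X → X}
    (hb : LocallyLipschitz b) {F : X → ℝ → (X →L[ℝ] ℝ) → ℝ} {w g : X → ℝ}
    (hw : IsViscositySolutionOn F Ω w) (hg : ContinuousOn g Ω)
    (hF : ∀ x ∈ Ω, ∀ p, F x (w x) p = g x - p (b x))
    {γ : ℝ → X} {S : ℝ} (hS : 0 ≤ S) (hγc : ContinuousOn γ (Icc 0 S))
    (hγ : ∀ s ∈ Ico 0 S, HasDerivWithinAt γ (b (γ s)) (Ici s) s)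
    (hγΩ : ∀ s ∈ Icc 0 S, γ s ∈ Ω) :
    w (γ S) - w (γ 0) = ∫ s in (0 : ℝ)..S, g (γ s) := by
  apply le_antisymm
  · have := integral_le_sub_of_superdifferential hΩ hb hw.1.neg hg.neg (fun x hx p hp => by
      have h1 := hw.2.2 x hx _ (neg_mem_subdifferential_of_neg hp)
      rw [hF x hx] at h1
      simp only [_root_.neg_apply] at h1
      simp only [Pi.neg_apply]
      linarith) hS hγc hγ hγΩ
    simp only [Pi.neg_apply, intervalIntegral.integral_neg] at this
    linarith
  · exact integral_le_sub_of_superdifferential hΩ hb hw.1 hg (fun x hx p hp => by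
      have h1 := hw.2.1 x hx _ hp
      rw [hF x hx] at h1
      linarith) hS hγc hγ hγΩ

end Viscosity

/-! ### The weighted transport semigroup and its Cauchy problem -/

section Cauchy

variable {n : ℕ} {f : EuclideanSpace ℝ (Fin n) → EuclideanSpace ℝ (Fin n)}
  {η h : EuclideanSpace ℝ (Fin n) → ℝ}

theorem continuousOn_comp_flowMap (hc : ForwardComplete f) (hη : Continuous η)
    (x : EuclideanSpace ℝ (Fin n)) : ContinuousOn (fun r => η (flowMap f r x)) (Ici 0) :=
  hη.comp_continuousOn (continuousOn_flowMap_left hc x)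

theorem intervalIntegrable_comp_flowMap (hc : ForwardComplete f) (hη : Continuous η)
    (x : EuclideanSpace ℝ (Fin n)) {a b : ℝ} (ha : 0 ≤ a) (hb : 0 ≤ b) :
    IntervalIntegrable (fun r => η (flowMap f r x)) volume a b :=
  ContinuousOn.intervalIntegrable
    ((continuousOn_comp_flowMap hc hη x).mono fun _ hr => (le_min ha hb).trans hr.1)

theorem integral_flowMap_add (hf : LocallyLipschitz f) (hc : ForwardComplete f)
    (hη : Continuous η) {s t : ℝ} (hs : 0 ≤ s) (ht : 0 ≤ t) (x : EuclideanSpace ℝ (Fin n)) :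
    ∫ r in (0 : ℝ)..(s + t), η (flowMap f r x) =
      (∫ r in (0 : ℝ)..s, η (flowMap f r x)) +
        ∫ r in (0 : ℝ)..t, η (flowMap f r (flowMap f s x)) := by
  rw [← intervalIntegral.integral_add_adjacent_intervals
    (intervalIntegrable_comp_flowMap hc hη x le_rfl hs)
    (intervalIntegrable_comp_flowMap hc hη x hs (add_nonneg hs ht))]
  congr 1
  have h1 : ∫ r in (0 : ℝ)..t, η (flowMap f r (flowMap f s x)) =
      ∫ r in (0 : ℝ)..t, η (flowMap f (r + s) x) := by
    refine intervalIntegral.integral_congr fun r hr => ?_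
    rw [uIcc_of_le ht] at hr
    simp only [add_comm r s, flowMap_add hf hc hs hr.1]
  rw [h1, intervalIntegral.integral_comp_add_right (fun r => η (flowMap f r x))]
  simp [add_comm]

theorem zubovKoopman_add (hf : LocallyLipschitz f) (hc : ForwardComplete f)
    (hη : Continuous η) {s t : ℝ} (hs : 0 ≤ s) (ht : 0 ≤ t) (x : EuclideanSpace ℝ (Fin n)) :
    zubovKoopman f η (s + t) h x =
      Real.exp (-∫ r in (0 : ℝ)..s, η (flowMap f r x)) *
        zubovKoopman f η t h (flowMap f s x) := by
  simp only [zubovKoopman]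
  rw [integral_flowMap_add hf hc hη hs ht, flowMap_add hf hc hs ht, neg_add, Real.exp_add,
    mul_assoc]

theorem continuousOn_integral_flowMap (hf : LocallyLipschitz f) (hc : ForwardComplete f)
    (hη : Continuous η) :
    ContinuousOn (fun z : ℝ × EuclideanSpace ℝ (Fin n) =>
      ∫ r in (0 : ℝ)..z.1, η (flowMap f r z.2)) (Ici 0 ×ˢ univ) := by
  have h1 : Continuous fun z : ℝ × EuclideanSpace ℝ (Fin n) =>
      ∫ r in (0 : ℝ)..z.1, η (flowMap f (max r 0) z.2) := by
    refine intervalIntegral.continuous_parametric_intervalIntegral_of_continuous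
      (f := fun z : ℝ × EuclideanSpace ℝ (Fin n) => fun r => η (flowMap f (max r 0) z.2)) ?_
      continuous_fst
    exact hη.comp ((continuous_flowMap_max hf hc).comp
      (continuous_snd.prodMk (continuous_snd.comp continuous_fst)))
  refine h1.continuousOn.congr fun z hz => ?_
  refine intervalIntegral.integral_congr fun r hr => ?_
  rw [uIcc_of_le (show (0 : ℝ) ≤ z.1 from hz.1)] at hr
  simp only [max_eq_left hr.1]

theorem continuousOn_zubovKoopman (hf : LocallyLipschitz f) (hc : ForwardComplete f)
    (hη : Continuous η) (hh : Continuous h) :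
    ContinuousOn (fun z : ℝ × EuclideanSpace ℝ (Fin n) => zubovKoopman f η z.1 h z.2)
      (Ici 0 ×ˢ univ) :=
  (Real.continuous_exp.comp_continuousOn (continuousOn_integral_flowMap hf hc hη).neg).mul
    (hh.comp_continuousOn (continuousOn_flowMap hf hc))

theorem hasDerivWithinAt_integral_flowMap (hc : ForwardComplete f) (hη : Continuous η)
    (x : EuclideanSpace ℝ (Fin n)) {s : ℝ} (hs : 0 ≤ s) :
    HasDerivWithinAt (fun s => ∫ r in (0 : ℝ)..s, η (flowMap f r x)) (η (flowMap f s x))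
      (Ici s) s := by
  have hcont := continuousOn_comp_flowMap hc hη x
  have hIoi : Ioi s ⊆ Ici 0 := fun r hr => hs.trans (le_of_lt hr)
  refine intervalIntegral.integral_hasDerivWithinAt_right (t := Ioi s)
    (intervalIntegrable_comp_flowMap hc hη x le_rfl hs) ⟨Ici 0, ?_, ?_⟩ ?_
  · exact mem_of_superset self_mem_nhdsWithin hIoi
  · exact hcont.aestronglyMeasurable measurableSet_Ici
  · exact (hcont s hs).mono hIoi

theorem continuousOn_integral_flowMap_left (hc : ForwardComplete f) (hη : Continuous η)
    (x : EuclideanSpace ℝ (Fin n)) (T : ℝ) :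
    ContinuousOn (fun s => ∫ r in (0 : ℝ)..s, η (flowMap f r x)) (Icc 0 T) := by
  rcases le_or_gt 0 T with hT | hT
  · have := intervalIntegral.continuousOn_primitive_interval (a := 0) (b := T)
      (f := fun s => η (flowMap f s x)) (μ := volume) (by
        rw [uIcc_of_le hT]
        exact ((continuousOn_comp_flowMap hc hη x).mono Icc_subset_Ici_self).integrableOn_Icc)
    rwa [uIcc_of_le hT] at this
  · simp [Icc_eq_empty hT.not_ge]

/-- The characteristic of the Cauchy problem through `(t, x)`, run backwards in time, is an
integral curve of `(t, x) ↦ (-1, f x)`. -/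
theorem hasDerivWithinAt_characteristic (hc : ForwardComplete f)
    (t : ℝ) (x : EuclideanSpace ℝ (Fin n)) {s : ℝ} (hs : 0 ≤ s) :
    HasDerivWithinAt (fun s => (t - s, flowMap f s x)) (-1, f (flowMap f s x)) (Ici s) s := by
  have h1 : HasDerivWithinAt (fun s : ℝ => t - s) (-1) (Ici s) s := by
    simpa using (hasDerivWithinAt_id s (Ici s)).const_sub t
  exact h1.prodMk ((isForwardSolution_flowMap hc x).hasDerivWithinAt_Ici hs)

theorem feynmanKacHamiltonian_eq (z : ℝ × EuclideanSpace ℝ (Fin n)) (r : ℝ)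
    (p : ℝ × EuclideanSpace ℝ (Fin n) →L[ℝ] ℝ) :
    feynmanKacHamiltonian f η z r p = η z.2 * r - p (-1, f z.2) := by
  have : p (-1, f z.2) = -p (1, 0) + p (0, f z.2) := by
    rw [← map_neg, ← map_add]
    simp
  rw [feynmanKacHamiltonian, this]
  ring

theorem isFeynmanKacSolution_zubovKoopman (hf : LocallyLipschitz f) (hc : ForwardComplete f)
    (hη : Continuous η) (hh : Continuous h) :
    IsFeynmanKacSolution f η h (fun z => zubovKoopman f η z.1 h z.2) := by
  have hcont := continuousOn_zubovKoopman hf hc hη hh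
  -- along characteristics the solution grows at rate `η u`
  have hder : ∀ z ∈ (Ioi (0 : ℝ) ×ˢ (univ : Set (EuclideanSpace ℝ (Fin n)))),
      Tendsto (fun s : ℝ => (zubovKoopman f η (z.1 - s) h (flowMap f s z.2) -
        zubovKoopman f η z.1 h z.2) / s) (𝓝[>] 0)
        (𝓝 (η z.2 * zubovKoopman f η z.1 h z.2)) := by
    rintro ⟨t, x⟩ ⟨ht : 0 < t, -⟩
    simp only
    have h1 := ((hasDerivWithinAt_integral_flowMap hc hη x le_rfl).exp.mul_const
      (zubovKoopman f η t h x)).mono Ioi_subset_Ici_self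
    have h2 := (hasDerivWithinAt_iff_tendsto_slope' self_notMem_Ioi).1 h1
    simp only [intervalIntegral.integral_same, Real.exp_zero, one_mul, flowMap_zero hc] at h2
    refine h2.congr' ?_
    filter_upwards [Ioo_mem_nhdsGT ht] with s hs
    have h3 := zubovKoopman_add (h := h) hf hc hη hs.1.le (sub_nonneg.2 hs.2.le) x
    rw [add_sub_cancel] at h3
    rw [slope_def_field, sub_zero, intervalIntegral.integral_same, Real.exp_zero, one_mul]
    congr 2
    rw [h3, ← mul_assoc, ← Real.exp_add, add_neg_cancel, Real.exp_zero, one_mul]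
  have hchar : ∀ z : ℝ × EuclideanSpace ℝ (Fin n), HasDerivWithinAt
      (fun s => (z.1 - s, flowMap f s z.2)) (-1, f z.2) (Ici 0) 0 := fun z => by
    simpa [flowMap_zero hc] using hasDerivWithinAt_characteristic hc z.1 z.2 le_rfl
  refine ⟨hcont, ⟨hcont.mono (prod_mono_left Ioi_subset_Ici_self), ?_, ?_⟩, fun x => ?_⟩
  · intro z hz p hp
    rw [feynmanKacHamiltonian_eq, sub_nonpos]
    refine le_of_forall_pos_le_add fun ε hε => ?_
    exact le_of_tendsto (hder z hz) (eventually_slope_le_of_mem_superdifferential hp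
      (by simp [flowMap_zero hc]) (hchar z) hε)
  · intro z hz q hq
    rw [feynmanKacHamiltonian_eq, sub_nonneg]
    refine le_of_forall_pos_le_add fun ε hε => ?_
    have := ge_of_tendsto (hder z hz) (eventually_le_slope_of_mem_subdifferential hq
      (by simp [flowMap_zero hc]) (hchar z) hε)
    linarith
  · simp [zubovKoopman, flowMap_zero hc]

/-- Uniqueness for the Cauchy problem: along a characteristic, any solution multiplied by the
integrating factor is constant. -/
theorem IsFeynmanKacSolution.eq_zubovKoopman (hf : LocallyLipschitz f) (hc : ForwardComplete f)
    (hη : Continuous η) {w : ℝ × EuclideanSpace ℝ (Fin n) → ℝ}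
    (hw : IsFeynmanKacSolution f η h w) {t : ℝ} (ht : 0 ≤ t) (x : EuclideanSpace ℝ (Fin n)) :
    w (t, x) = zubovKoopman f η t h x := by
  obtain ⟨hwc, hwv, hw0⟩ := hw
  set γ : ℝ → ℝ × EuclideanSpace ℝ (Fin n) := fun s => (t - s, flowMap f s x) with hγ
  have hγc : ContinuousOn γ (Icc 0 t) := ContinuousOn.prodMk (by fun_prop)
    ((continuousOn_flowMap_left hc x).mono Icc_subset_Ici_self)
  have hwγ : ContinuousOn (fun s => w (γ s)) (Icc 0 t) :=
    hwc.comp hγc fun s hs => ⟨sub_nonneg.2 hs.2, mem_univ _⟩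
  have hb : LocallyLipschitz
      (fun z : ℝ × EuclideanSpace ℝ (Fin n) => ((-1 : ℝ), f z.2)) :=
    (LocallyLipschitz.const _).prodMk (hf.comp LipschitzWith.prod_snd.locallyLipschitz)
  have hgc : ContinuousOn (fun z : ℝ × EuclideanSpace ℝ (Fin n) => η z.2 * w z)
      (Ioi 0 ×ˢ univ) := (hη.comp continuous_snd).continuousOn.mul hwv.1
  have hint : ∀ s ∈ Ico 0 t, w (γ s) - w (γ 0) = ∫ r in (0 : ℝ)..s, η (γ r).2 * w (γ r) := by
    intro s hs
    exact hwv.sub_eq_integral (isOpen_Ioi.prod isOpen_univ) hb hgc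
      (fun z _ p => feynmanKacHamiltonian_eq z _ p) hs.1
      (hγc.mono (Icc_subset_Icc_right hs.2.le))
      (fun r hr => hasDerivWithinAt_characteristic hc t x hr.1)
      (fun r hr => ⟨sub_pos.2 (hr.2.trans_lt hs.2), mem_univ _⟩)
  have hgγ : ContinuousOn (fun r => η (γ r).2 * w (γ r)) (Icc 0 t) :=
    (hη.comp_continuousOn (continuous_snd.comp_continuousOn hγc)).mul hwγ
  have hderiv : ∀ s ∈ Ico 0 t,
      HasDerivWithinAt (fun s => w (γ s)) (η (γ s).2 * w (γ s)) (Ici s) s := by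
    intro s hs
    have hnhds : Icc 0 t ∈ 𝓝[>] s := by
      filter_upwards [Ioo_mem_nhdsGT hs.2] with r hr using ⟨hs.1.trans hr.1.le, hr.2.le⟩
    have hI := intervalIntegral.integral_hasDerivWithinAt_right (s := Ici s) (t := Ioi s)
      (f := fun r => η (γ r).2 * w (γ r)) (a := 0)
      (ContinuousOn.intervalIntegrable (by
        rw [uIcc_of_le hs.1]
        exact hgγ.mono (Icc_subset_Icc_right hs.2.le)))
      ⟨Icc 0 t, hnhds, hgγ.aestronglyMeasurable measurableSet_Icc⟩
      ((hgγ s ⟨hs.1, hs.2.le⟩).mono_of_mem_nhdsWithin hnhds)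
    refine (hI.const_add (w (γ 0))).congr_of_eventuallyEq ?_ ?_
    · filter_upwards [Ico_mem_nhdsGE hs.2] with r hr
      rw [← hint r ⟨hs.1.trans hr.1, hr.2⟩]
      ring
    · rw [← hint s hs]
      ring
  have hconst := constant_of_has_deriv_right_zero (a := 0) (b := t)
    (f := fun s => Real.exp (-∫ r in (0 : ℝ)..s, η (flowMap f r x)) * w (γ s))
    ((Real.continuous_exp.comp_continuousOn
      (continuousOn_integral_flowMap_left hc hη x t).neg).mul hwγ)
    (fun s hs => by
      have h1 := (hasDerivWithinAt_integral_flowMap hc hη x hs.1).neg.exp.mul (hderiv s hs)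
      refine h1.congr_deriv ?_
      simp only [hγ]
      ring) t ⟨ht, le_rfl⟩
  simp only [hγ, sub_self, hw0, sub_zero, flowMap_zero hc, intervalIntegral.integral_same,
    neg_zero, Real.exp_zero, one_mul] at hconst
  exact hconst.symm

end Cauchy

/-! ### Convergence to the stationary solution -/

section Convergence

variable {n : ℕ} {f : EuclideanSpace ℝ (Fin n) → EuclideanSpace ℝ (Fin n)}
  {η h : EuclideanSpace ℝ (Fin n) → ℝ} {xeq x : EuclideanSpace ℝ (Fin n)}

theorem integral_exp_neg_mul_le {c : ℝ} (hc : 0 < c) (t : ℝ) :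
    ∫ s in (0 : ℝ)..t, Real.exp (-(c * s)) ≤ 1 / c := by
  have h1 : ∀ s ∈ uIcc 0 t,
      HasDerivAt (fun s => -(Real.exp (-(c * s)) / c)) (Real.exp (-(c * s))) s := by
    intro s _
    have h2 : HasDerivAt (fun s : ℝ => -(c * s)) (-c) s := by
      simpa using ((hasDerivAt_id s).const_mul c).fun_neg
    refine (h2.exp.div_const c).fun_neg.congr_deriv ?_
    field_simp
  rw [intervalIntegral.integral_eq_sub_of_hasDerivAt h1
    (Continuous.intervalIntegrable (by fun_prop) _ _)]
  have : 0 < Real.exp (-(c * t)) / c := by positivity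
  simp only [mul_zero, neg_zero, Real.exp_zero]
  linarith

/-- Near an exponentially stable equilibrium, trajectories stay close, converge, and accumulate
little of a locally Lipschitz cost vanishing at the equilibrium. -/
theorem LocallyExponentiallyStable.exists_ball (hc : ForwardComplete f)
    (hη : LocallyLipschitz η) (hstab : LocallyExponentiallyStable f xeq) (hηeq : η xeq = 0)
    {ε : ℝ} (hε : 0 < ε) :
    ∃ r > (0 : ℝ), ∀ y, ‖y - xeq‖ ≤ r →
      Tendsto (fun t : ℝ => flowMap f t y) atTop (𝓝 xeq) ∧
      ∀ t : ℝ, 0 ≤ t → ‖flowMap f t y - xeq‖ ≤ ε ∧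
        ∫ s in (0 : ℝ)..t, η (flowMap f s y) ≤ ε := by
  obtain ⟨δ, hδ, M, hM, c, hcpos, hexp⟩ := hstab
  obtain ⟨K, N, hN, hK⟩ := hη xeq
  obtain ⟨ρ, hρ, hρN⟩ := Metric.mem_nhds_iff.1 hN
  have hηK : ∀ z, ‖z - xeq‖ < ρ → η z ≤ K * ‖z - xeq‖ := fun z hz => by
    have := hK.dist_le_mul z (hρN (by rwa [Metric.mem_ball, dist_eq_norm])) xeq
      (mem_of_mem_nhds hN)
    rw [hηeq, Real.dist_eq, sub_zero, dist_eq_norm] at this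
    exact (le_abs_self _).trans this
  set r : ℝ := min δ (min (ρ / (2 * M)) (min (ε / M) (ε * c / (M * (K + 1))))) with hr
  have hK0 : (0 : ℝ) ≤ K := K.2
  have hr0 : 0 < r := by positivity
  have hMρ : M * r < ρ := by
    have : r ≤ ρ / (2 * M) := (min_le_right _ _).trans (min_le_left _ _)
    have := (le_div_iff₀ (by positivity)).1 this
    linarith
  have hMε : M * r ≤ ε := by
    have : r ≤ ε / M := (min_le_right _ _).trans ((min_le_right _ _).trans (min_le_left _ _))
    have := (le_div_iff₀ hM).1 this
    linarith
  have hKMr : K * (M * r) * (1 / c) ≤ ε := by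
    have : r ≤ ε * c / (M * (K + 1)) :=
      (min_le_right _ _).trans ((min_le_right _ _).trans (min_le_right _ _))
    have := (le_div_iff₀ (by positivity)).1 this
    rw [mul_one_div, div_le_iff₀ hcpos]
    nlinarith [mul_pos hM hr0]
  have hbd : ∀ y, ‖y - xeq‖ ≤ r → ∀ t : ℝ, 0 ≤ t →
      ‖flowMap f t y - xeq‖ ≤ M * r * Real.exp (-(c * t)) := fun y hy t ht =>
    (hexp y (hy.trans (min_le_left _ _)) t ht).trans (by gcongr)
  have hbd' : ∀ y, ‖y - xeq‖ ≤ r → ∀ t : ℝ, 0 ≤ t → ‖flowMap f t y - xeq‖ ≤ M * r :=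
    fun y hy t ht => (hbd y hy t ht).trans
      (mul_le_of_le_one_right (by positivity) (Real.exp_le_one_iff.2 (by
        have := mul_nonneg hcpos.le ht
        linarith)))
  refine ⟨r, hr0, fun y hy => ⟨?_, fun t ht => ⟨(hbd' y hy t ht).trans hMε, ?_⟩⟩⟩
  · rw [tendsto_iff_norm_sub_tendsto_zero]
    have hlim : Tendsto (fun t : ℝ => M * r * Real.exp (-(c * t))) atTop (𝓝 (M * r * 0)) :=
      (Real.tendsto_exp_atBot.comp
        (tendsto_neg_atTop_atBot.comp (tendsto_id.const_mul_atTop hcpos))).const_mul _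
    rw [mul_zero] at hlim
    exact squeeze_zero' (Eventually.of_forall fun _ => norm_nonneg _)
      (by filter_upwards [eventually_ge_atTop 0] with t ht using hbd y hy t ht) hlim
  · calc ∫ s in (0 : ℝ)..t, η (flowMap f s y)
        ≤ ∫ s in (0 : ℝ)..t, K * (M * r) * Real.exp (-(c * s)) := by
          refine intervalIntegral.integral_mono_on ht
            (intervalIntegrable_comp_flowMap hc hη.continuous y le_rfl ht)
            (Continuous.intervalIntegrable (by fun_prop) _ _) fun s hs => ?_
          refine (hηK _ ((hbd' y hy s hs.1).trans_lt hMρ)).trans ?_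
          rw [mul_assoc]
          gcongr
          exact hbd y hy s hs.1
      _ = K * (M * r) * ∫ s in (0 : ℝ)..t, Real.exp (-(c * s)) :=
          intervalIntegral.integral_const_mul _ _
      _ ≤ K * (M * r) * (1 / c) := by
          gcongr
          exact integral_exp_neg_mul_le hcpos t
      _ ≤ ε := hKMr

theorem setLIntegral_Icc_flowMap (hc : ForwardComplete f) (hη : Continuous η)
    (hη0 : ∀ x, 0 ≤ η x) (x : EuclideanSpace ℝ (Fin n)) {t : ℝ} (ht : 0 ≤ t) :
    ∫⁻ s in Icc 0 t, ENNReal.ofReal (η (flowMap f s x)) =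
      ENNReal.ofReal (∫ s in (0 : ℝ)..t, η (flowMap f s x)) := by
  rw [intervalIntegral.integral_of_le ht, ← integral_Icc_eq_integral_Ioc,
    ofReal_integral_eq_lintegral_ofReal]
  · exact ((continuousOn_comp_flowMap hc hη x).mono Icc_subset_Ici_self).integrableOn_Icc
  · exact Eventually.of_forall fun s => hη0 _

theorem integral_le_zubovV (hc : ForwardComplete f) (hη : Continuous η)
    (hη0 : ∀ x, 0 ≤ η x) (x : EuclideanSpace ℝ (Fin n)) {t : ℝ} (ht : 0 ≤ t) :
    ENNReal.ofReal (∫ s in (0 : ℝ)..t, η (flowMap f s x)) ≤ zubovV f η x := by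
  rw [← setLIntegral_Icc_flowMap hc hη hη0 x ht]
  exact lintegral_mono_set Icc_subset_Ici_self

theorem zubovV_le (hc : ForwardComplete f) (hη : Continuous η)
    (hη0 : ∀ x, 0 ≤ η x) (x : EuclideanSpace ℝ (Fin n)) {B : ℝ}
    (hB : ∀ k : ℕ, ∫ s in (0 : ℝ)..k, η (flowMap f s x) ≤ B) :
    zubovV f η x ≤ ENNReal.ofReal B := by
  have hU : Ici (0 : ℝ) = ⋃ k : ℕ, Icc (0 : ℝ) k := by
    ext s
    simp only [mem_Ici, mem_iUnion, mem_Icc, exists_and_left, iff_self_and]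
    exact fun _ => exists_nat_ge s
  rw [zubovV, hU, setLIntegral_iUnion_of_directed _ (directed_of_isDirected_le
    fun i j hij => Icc_subset_Icc_right (by exact_mod_cast hij))]
  refine iSup_le fun k => ?_
  rw [setLIntegral_Icc_flowMap hc hη hη0 x (Nat.cast_nonneg k)]
  exact ENNReal.ofReal_le_ofReal (hB k)

theorem integral_flowMap_mono (hc : ForwardComplete f) (hη : Continuous η)
    (hη0 : ∀ x, 0 ≤ η x) (x : EuclideanSpace ℝ (Fin n)) {s t : ℝ} (hs : 0 ≤ s) (hst : s ≤ t) :
    ∫ r in (0 : ℝ)..s, η (flowMap f r x) ≤ ∫ r in (0 : ℝ)..t, η (flowMap f r x) :=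
  intervalIntegral.integral_mono_interval le_rfl hs hst
    (Eventually.of_forall fun _ => hη0 _)
    (intervalIntegrable_comp_flowMap hc hη x le_rfl (hs.trans hst))

theorem integral_flowMap_nonneg (hη0 : ∀ x, 0 ≤ η x) (x : EuclideanSpace ℝ (Fin n)) {t : ℝ}
    (ht : 0 ≤ t) : 0 ≤ ∫ r in (0 : ℝ)..t, η (flowMap f r x) :=
  intervalIntegral.integral_nonneg ht fun _ _ => hη0 _

theorem abs_exp_mul_sub_exp_mul_le {a b p q C : ℝ} (ha : 0 ≤ a) (hab : a ≤ b) (hq : |q| ≤ C) :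
    |Real.exp (-a) * p - Real.exp (-b) * q| ≤ |p - q| + C * (b - a) := by
  have h1 : Real.exp (-a) * p - Real.exp (-b) * q =
      Real.exp (-a) * (p - q) + (Real.exp (-a) - Real.exp (-b)) * q := by ring
  have h2 : Real.exp (-a) ≤ 1 := Real.exp_le_one_iff.2 (by linarith)
  have h3 : |Real.exp (-a) - Real.exp (-b)| ≤ b - a := by
    rw [abs_of_nonneg (sub_nonneg.2 (Real.exp_le_exp.2 (by linarith)))]
    have h4 : Real.exp (-b) = Real.exp (-a) * Real.exp (-(b - a)) := by
      rw [← Real.exp_add]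
      ring_nf
    have h5 := Real.add_one_le_exp (-(b - a))
    have h6 := Real.exp_pos (-a)
    nlinarith
  rw [h1]
  refine (abs_add_le _ _).trans (add_le_add ?_ ?_)
  · rw [abs_mul, abs_of_pos (Real.exp_pos _)]
    exact mul_le_of_le_one_left (abs_nonneg _) h2
  · rw [abs_mul, mul_comm]
    exact mul_le_mul hq h3 (abs_nonneg _) ((abs_nonneg _).trans hq)

/-- If the cost rate is bounded below away from the equilibrium, then `T_t h → U_h` uniformly on
the whole space: by time `T` a trajectory has either entered a small ball around the equilibrium,
after which nothing changes much, or has accumulated so much cost that both sides are small. -/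
theorem exists_forall_abs_zubovKoopman_sub_zubovU_le (hf : LocallyLipschitz f)
    (hc : ForwardComplete f) (hη : LocallyLipschitz η) (hη0 : ∀ x, 0 ≤ η x)
    (hh : Continuous h) {C : ℝ} (hC : ∀ x, |h x| ≤ C)
    (hstab : LocallyExponentiallyStable f xeq) (hηeq : η xeq = 0)
    (hinf : ∀ r > (0 : ℝ), ∃ c > (0 : ℝ), ∀ x, r ≤ ‖x - xeq‖ → c ≤ η x) {ε : ℝ} (hε : 0 < ε) :
    ∃ T > (0 : ℝ), ∀ t ≥ T, ∀ x, |zubovKoopman f η t h x - zubovU f η h x| ≤ ε := by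
  have hηc := hη.continuous
  have hC0 : 0 ≤ C := (abs_nonneg _).trans (hC xeq)
  obtain ⟨ε₀, hε₀, hhε⟩ := Metric.continuousAt_iff.1 hh.continuousAt (ε / 2) (half_pos hε)
  set ε₁ := min (ε₀ / 2) (ε / (2 * (C + 1))) with hε₁
  have hε₁pos : 0 < ε₁ := by positivity
  have hhε₁ : ∀ y, ‖y - xeq‖ ≤ ε₁ → |h y - h xeq| ≤ ε / 2 := fun y hy => by
    rw [← Real.dist_eq]
    refine (hhε ?_).le
    rw [dist_eq_norm]
    exact (hy.trans (min_le_left _ _)).trans_lt (half_lt_self hε₀)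
  have hCε₁ : C * ε₁ ≤ ε / 2 := by
    have := (le_div_iff₀ (by positivity)).1 (min_le_right (ε₀ / 2) (ε / (2 * (C + 1))))
    rw [← hε₁] at this
    nlinarith
  obtain ⟨r, hr, hball⟩ := hstab.exists_ball hc hη hηeq hε₁pos
  obtain ⟨c, hcpos, hcη⟩ := hinf r hr
  obtain ⟨T, hT, hTε⟩ : ∃ T > (0 : ℝ), C * Real.exp (-(c * T)) ≤ ε / 2 := by
    have hlim : Tendsto (fun t : ℝ => C * Real.exp (-(c * t))) atTop (𝓝 (C * 0)) :=
      (Real.tendsto_exp_atBot.comp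
        (tendsto_neg_atTop_atBot.comp (tendsto_id.const_mul_atTop hcpos))).const_mul _
    rw [mul_zero] at hlim
    obtain ⟨T, h1, h2⟩ :=
      ((eventually_gt_atTop 0).and (hlim.eventually (gt_mem_nhds (half_pos hε)))).exists
    exact ⟨T, h1, h2.le⟩
  refine ⟨T, hT, fun t htT x => ?_⟩
  have ht : 0 ≤ t := hT.le.trans htT
  set a := ∫ s in (0 : ℝ)..t, η (flowMap f s x) with ha
  have ha0 : 0 ≤ a := integral_flowMap_nonneg hη0 x ht
  by_cases hcase : ∃ t₀ ∈ Icc 0 t, ‖flowMap f t₀ x - xeq‖ ≤ r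
  · obtain ⟨t₀, ht₀, hy⟩ := hcase
    obtain ⟨hytend, hybd⟩ := hball _ hy
    set a₀ := ∫ s in (0 : ℝ)..t₀, η (flowMap f s x) with ha₀
    have ha₀a : a₀ ≤ a := integral_flowMap_mono hc hηc hη0 x ht₀.1 ht₀.2
    have hV_le : zubovV f η x ≤ ENNReal.ofReal (a₀ + ε₁) := by
      refine zubovV_le hc hηc hη0 x fun k => ?_
      have h1 : ∫ s in (0 : ℝ)..k, η (flowMap f s x) ≤
          ∫ s in (0 : ℝ)..(t₀ + k), η (flowMap f s x) :=
        integral_flowMap_mono hc hηc hη0 x (Nat.cast_nonneg k) (by linarith [ht₀.1])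
      rw [integral_flowMap_add hf hc hηc ht₀.1 (Nat.cast_nonneg k)] at h1
      linarith [(hybd k (Nat.cast_nonneg k)).2]
    have hVlt : zubovV f η x < ∞ := hV_le.trans_lt ENNReal.ofReal_lt_top
    have ha₀0 : 0 ≤ a₀ := integral_flowMap_nonneg hη0 x ht₀.1
    have hV1 : (zubovV f η x).toReal ≤ a₀ + ε₁ := by
      have := ENNReal.toReal_mono ENNReal.ofReal_ne_top hV_le
      rwa [ENNReal.toReal_ofReal (by positivity)] at this
    have hV2 : a ≤ (zubovV f η x).toReal := by
      have := ENNReal.toReal_mono hVlt.ne (integral_le_zubovV hc hηc hη0 x ht)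
      rwa [ENNReal.toReal_ofReal ha0] at this
    have hlim : limUnder atTop (fun t : ℝ => flowMap f t x) = xeq := by
      refine Tendsto.limUnder_eq ?_
      have h1 := hytend.comp (tendsto_atTop_add_const_right atTop (-t₀) tendsto_id)
      refine h1.congr' ?_
      filter_upwards [eventually_ge_atTop t₀] with s hs
      simp only [Function.comp_apply, id]
      rw [← flowMap_add hf hc ht₀.1 (by linarith)]
      congr 1
      ring
    have hφ : flowMap f t x = flowMap f (t - t₀) (flowMap f t₀ x) := by
      rw [← flowMap_add hf hc ht₀.1 (sub_nonneg.2 ht₀.2), add_sub_cancel]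
    rw [zubovU, if_pos hVlt, hlim, zubovKoopman]
    refine (abs_exp_mul_sub_exp_mul_le ha0 hV2 (hC xeq)).trans ?_
    have h1 : |h (flowMap f t x) - h xeq| ≤ ε / 2 :=
      hhε₁ _ (by rw [hφ]; exact (hybd _ (sub_nonneg.2 ht₀.2)).1)
    have h2 : C * ((zubovV f η x).toReal - a) ≤ C * ε₁ := by
      gcongr
      linarith
    linarith
  · push Not at hcase
    have hca : c * T ≤ a := by
      calc c * T ≤ c * t := by gcongr
        _ = ∫ _ in (0 : ℝ)..t, c := by simp [mul_comm]
        _ ≤ a := intervalIntegral.integral_mono_on ht (by simp)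
          (intervalIntegrable_comp_flowMap hc hηc x le_rfl ht)
          fun s hs => hcη _ (hcase s hs).le
    have hsmall : ∀ b, a ≤ b → ∀ z, |Real.exp (-b) * h z| ≤ ε / 2 := fun b hb z => by
      rw [abs_mul, abs_of_pos (Real.exp_pos _), mul_comm]
      refine le_trans ?_ hTε
      gcongr
      · exact hC z
      · linarith
    have h1 : |zubovKoopman f η t h x| ≤ ε / 2 := hsmall a le_rfl _
    have h2 : |zubovU f η h x| ≤ ε / 2 := by
      rw [zubovU]
      split_ifs with hV
      · refine hsmall _ ?_ _
        have := ENNReal.toReal_mono hV.ne (integral_le_zubovV hc hηc hη0 x ht)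
        rwa [ENNReal.toReal_ofReal ha0] at this
      · simpa using (half_pos hε).le
    refine (abs_sub _ _).trans ?_
    linarith

end Convergence

/-! ### Derivatives along the flow -/

section FlowDerivative

variable {n : ℕ} {f : EuclideanSpace ℝ (Fin n) → EuclideanSpace ℝ (Fin n)}
  {η v w u O : EuclideanSpace ℝ (Fin n) → ℝ} {xeq x : EuclideanSpace ℝ (Fin n)}

/-- The upper right Dini derivative of `v` along the flow of `f`. -/
noncomputable def flowDini (f : EuclideanSpace ℝ (Fin n) → EuclideanSpace ℝ (Fin n))
    (v : EuclideanSpace ℝ (Fin n) → ℝ) (x : EuclideanSpace ℝ (Fin n)) : ℝ :=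
  limsup (fun s : ℝ => (v (flowMap f s x) - v x) / s) (𝓝[>] 0)

theorem flowDini_mem_Icc {a b : ℝ}
    (h : ∀ᶠ s in 𝓝[>] (0 : ℝ), (v (flowMap f s x) - v x) / s ∈ Icc a b) :
    flowDini f v x ∈ Icc a b := by
  have ha : ∀ᶠ s in 𝓝[>] (0 : ℝ), a ≤ (v (flowMap f s x) - v x) / s := h.mono fun _ hs => hs.1
  have hb : ∀ᶠ s in 𝓝[>] (0 : ℝ), (v (flowMap f s x) - v x) / s ≤ b := h.mono fun _ hs => hs.2
  constructor
  · refine le_limsup_of_le ⟨b, hb⟩ fun c hc => ?_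
    obtain ⟨s, h1, h2⟩ := (ha.and hc).exists
    exact h1.trans h2
  · exact limsup_le_of_le (IsBoundedUnder.isCoboundedUnder_le ⟨a, ha⟩) hb

theorem tendsto_flowMap_zero (hc : ForwardComplete f) (x : EuclideanSpace ℝ (Fin n)) :
    Tendsto (fun s : ℝ => flowMap f s x) (𝓝[>] 0) (𝓝 x) := by
  have := (continuousOn_flowMap_left hc x 0 self_mem_Ici).mono Ioi_subset_Ici_self
  rwa [ContinuousWithinAt, flowMap_zero hc] at this

theorem hasDerivWithinAt_flowMap_zero (hc : ForwardComplete f) (x : EuclideanSpace ℝ (Fin n)) :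
    HasDerivWithinAt (fun s : ℝ => flowMap f s x) (f x) (Ici 0) 0 := by
  simpa [flowMap_zero hc] using (isForwardSolution_flowMap hc x).hasDerivWithinAt_Ici le_rfl

theorem tendsto_norm_flowMap_sub_div (hc : ForwardComplete f) (x : EuclideanSpace ℝ (Fin n)) :
    Tendsto (fun s : ℝ => ‖flowMap f s x - x‖ / s) (𝓝[>] 0) (𝓝 ‖f x‖) := by
  have h1 := ((hasDerivWithinAt_iff_tendsto_slope' self_notMem_Ioi).1
    ((hasDerivWithinAt_flowMap_zero hc x).mono Ioi_subset_Ici_self)).norm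
  refine h1.congr' ?_
  filter_upwards [self_mem_nhdsWithin] with s (hs : 0 < s)
  rw [slope_def_module, sub_zero, flowMap_zero hc, norm_smul, norm_inv,
    Real.norm_of_nonneg hs.le]
  ring

theorem exists_eventually_abs_slope_le (hc : ForwardComplete f) {K : ℝ≥0}
    {N : Set (EuclideanSpace ℝ (Fin n))} (hN : N ∈ 𝓝 x) (hv : LipschitzOnWith K v N) :
    ∃ B : ℝ, ∀ᶠ s in 𝓝[>] (0 : ℝ), |(v (flowMap f s x) - v x) / s| ≤ B := by
  refine ⟨K * (‖f x‖ + 1), ?_⟩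
  filter_upwards [(tendsto_flowMap_zero hc x).eventually hN, self_mem_nhdsWithin,
    (tendsto_norm_flowMap_sub_div hc x).eventually (gt_mem_nhds (lt_add_one _))]
    with s hs (hs0 : 0 < s) hs1
  have h1 := hv.dist_le_mul _ hs _ (mem_of_mem_nhds hN)
  rw [Real.dist_eq, dist_eq_norm] at h1
  rw [abs_div, abs_of_pos hs0]
  calc |v (flowMap f s x) - v x| / s ≤ K * ‖flowMap f s x - x‖ / s := by gcongr
    _ = K * (‖flowMap f s x - x‖ / s) := by ring
    _ ≤ K * (‖f x‖ + 1) := by gcongr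

theorem LocallyLipschitz.exists_lipschitzOnWith_neg_log (hu : LocallyLipschitz u)
    (hx : 0 < u x) :
    ∃ K : ℝ≥0, ∃ N ∈ 𝓝 x, LipschitzOnWith K (fun y => -Real.log (u y)) N := by
  obtain ⟨K₁, N₁, hN₁, h1⟩ := hu x
  obtain ⟨K₂, N₂, hN₂, h2⟩ :=
    (Real.contDiffAt_log (n := 1).2 hx.ne').exists_lipschitzOnWith
  refine ⟨K₂ * K₁, N₁ ∩ u ⁻¹' N₂, inter_mem hN₁ (hu.continuous.continuousAt hN₂), ?_⟩
  exact (h2.comp (h1.mono inter_subset_left) fun y hy => hy.2).neg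

/-- With `O := η + (upper Dini derivative of v along the flow)`, any function `v` that is
Lipschitz near each point of `Ω` is a viscosity solution of `-∇v · f - η + O = 0`: the Dini
derivative lies between the values prescribed by subgradients and by supergradients. -/
theorem isViscositySolutionOn_flowDini (hc : ForwardComplete f)
    {Ω : Set (EuclideanSpace ℝ (Fin n))}
    (hv : ∀ x ∈ Ω, ∃ K : ℝ≥0, ∃ N ∈ 𝓝 x, LipschitzOnWith K v N) :
    IsViscositySolutionOn (lyapunovHamiltonian f η (fun x => η x + flowDini f v x)) Ω v := by
  refine ⟨fun x hx => ?_, fun x hx p hp => ?_, fun x hx q hq => ?_⟩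
  · obtain ⟨K, N, hN, hK⟩ := hv x hx
    exact (hK.continuousOn.continuousAt hN).continuousWithinAt
  all_goals
    obtain ⟨K, N, hN, hK⟩ := hv x hx
    obtain ⟨B, hB⟩ := exists_eventually_abs_slope_le hc hN hK
    simp only [lyapunovHamiltonian]
  · have : flowDini f v x ≤ p (f x) := le_of_forall_pos_le_add fun ε hε =>
      (flowDini_mem_Icc (a := -B) (by
        filter_upwards [hB, eventually_slope_le_of_mem_superdifferential hp (flowMap_zero hc x)
          (hasDerivWithinAt_flowMap_zero hc x) hε] with s h1 h2
        exact ⟨(abs_le.1 h1).1, h2⟩)).2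
    linarith
  · have : q (f x) ≤ flowDini f v x := le_of_forall_pos_sub_le fun ε hε =>
      (flowDini_mem_Icc (b := B) (by
        filter_upwards [hB, eventually_le_slope_of_mem_subdifferential hq (flowMap_zero hc x)
          (hasDerivWithinAt_flowMap_zero hc x) hε] with s h1 h2
        exact ⟨h2, (abs_le.1 h1).2⟩)).1
    linarith

/-! ### Uniqueness for the perturbed Lyapunov equation -/

theorem IsViscositySolutionOn.mono {X : Type*} [NormedAddCommGroup X] [NormedSpace ℝ X]
    {F : X → ℝ → (X →L[ℝ] ℝ) → ℝ} {Ω Ω' : Set X} {v : X → ℝ}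
    (h : IsViscositySolutionOn F Ω v) (hΩ : Ω' ⊆ Ω) : IsViscositySolutionOn F Ω' v :=
  ⟨h.1.mono hΩ, fun x hx => h.2.1 x (hΩ hx), fun x hx => h.2.2 x (hΩ hx)⟩

theorem IsViscositySolutionOn.fderiv_apply_eq {Ω : Set (EuclideanSpace ℝ (Fin n))}
    (h : IsViscositySolutionOn (lyapunovHamiltonian f η O) Ω v) (hx : x ∈ Ω)
    {p : EuclideanSpace ℝ (Fin n) →L[ℝ] ℝ} (hp : HasFDerivAt v p x) :
    p (f x) = O x - η x := by
  have h1 := h.2.1 x hx p hp.mem_superdifferential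
  have h2 := h.2.2 x hx p hp.mem_subdifferential
  simp only [lyapunovHamiltonian] at h1 h2
  linarith

/-- A viscosity solution with continuous data is determined along trajectories by its starting
value. -/
theorem IsViscositySolutionOn.sub_flowMap_eq_integral (hf : LocallyLipschitz f)
    (hc : ForwardComplete f) (hη : Continuous η) {Ω : Set (EuclideanSpace ℝ (Fin n))}
    (hΩ : IsOpen Ω) (hinv : ∀ x ∈ Ω, ∀ s : ℝ, 0 ≤ s → flowMap f s x ∈ Ω)
    (hO : ContinuousOn O Ω) (hw : IsViscositySolutionOn (lyapunovHamiltonian f η O) Ω w)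
    (hx : x ∈ Ω) {s : ℝ} (hs : 0 ≤ s) :
    w (flowMap f s x) - w x =
      ∫ r in (0 : ℝ)..s, (O (flowMap f r x) - η (flowMap f r x)) := by
  have := hw.sub_eq_integral hΩ hf (g := fun x => O x - η x) (hO.sub hη.continuousOn)
    (fun x _ p => by simp only [lyapunovHamiltonian]; ring) hs
    ((continuousOn_flowMap_left hc x).mono Icc_subset_Ici_self)
    (fun r hr => (isForwardSolution_flowMap hc x).hasDerivWithinAt_Ici hr.1)
    (fun r hr => hinv x hx r hr.1)
  simpa [flowMap_zero hc] using this

/-- **Rademacher's theorem** for locally Lipschitz functions on open sets. -/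
theorem LocallyLipschitzOn.ae_differentiableAt {Ω : Set (EuclideanSpace ℝ (Fin n))}
    (hΩ : IsOpen Ω) (hw : LocallyLipschitzOn Ω w) :
    ∀ᵐ x, x ∈ Ω → DifferentiableAt ℝ w x := by
  have : (volume : Measure (EuclideanSpace ℝ (Fin n)))
      {x | x ∈ Ω ∧ ¬DifferentiableAt ℝ w x} = 0 := by
    refine measure_null_of_locally_null _ fun x hx => ?_
    obtain ⟨K, N, hN, hK⟩ := hw hx.1
    rw [hΩ.nhdsWithin_eq hx.1] at hN
    have h1 : ∀ᵐ y, y ∈ interior N → DifferentiableAt ℝ w y := by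
      filter_upwards [(hK.mono interior_subset).ae_differentiableWithinAt_of_mem
        (μ := (volume : Measure (EuclideanSpace ℝ (Fin n))))] with y hy hyN
      exact (hy hyN).differentiableAt (isOpen_interior.mem_nhds hyN)
    refine ⟨{x | x ∈ Ω ∧ ¬DifferentiableAt ℝ w x} ∩ interior N, ?_, ?_⟩
    · exact inter_mem_nhdsWithin _ (interior_mem_nhds.2 hN)
    · refine measure_mono_null ?_ h1
      rintro y ⟨hy1, hy2⟩ hy3
      exact hy1.2 (hy3 hy2)
  filter_upwards [show ∀ᵐ x, ¬(x ∈ Ω ∧ ¬DifferentiableAt ℝ w x) from by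
    rw [ae_iff]; simpa using this] with x hx hxΩ
  by_contra hcon
  exact hx ⟨hxΩ, hcon⟩

theorem measure_eq_zero_iff_hausdorffMeasure (N : Set (EuclideanSpace ℝ (Fin n))) :
    volume N = 0 ↔
      μH[Module.finrank ℝ (EuclideanSpace ℝ (Fin n))] N = 0 := by
  constructor
  · intro h
    rw [Measure.isAddLeftInvariant_eq_smul
      (μH[Module.finrank ℝ (EuclideanSpace ℝ (Fin n))] : Measure (EuclideanSpace ℝ (Fin n)))
      (volume : Measure (EuclideanSpace ℝ (Fin n)))]
    simp [h]
  · intro h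
    rw [Measure.isAddLeftInvariant_eq_smul
      (volume : Measure (EuclideanSpace ℝ (Fin n)))
      (μH[Module.finrank ℝ (EuclideanSpace ℝ (Fin n))] : Measure (EuclideanSpace ℝ (Fin n)))]
    rw [Measure.smul_apply, h, smul_zero]

/-- Preimages of null sets under the flow are null, locally, since the flow has a Lipschitz
inverse. -/
theorem exists_ball_ae_flowMap_notMem (hf : LocallyLipschitz f) (hc : ForwardComplete f)
    (x₀ : EuclideanSpace ℝ (Fin n)) (T : ℝ) :
    ∃ δ > (0 : ℝ), ∀ N : Set (EuclideanSpace ℝ (Fin n)), volume N = 0 → ∀ s ∈ Icc 0 T,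
      ∀ᵐ x ∂(volume.restrict (Metric.ball x₀ δ)), flowMap f s x ∉ N := by
  obtain ⟨δ, hδ, C, -, L, hL, hC⟩ := exists_flowMap_mem_of_isCompact hf hc x₀ T
  refine ⟨δ, hδ, fun N hN s hs => ?_⟩
  have hanti : AntilipschitzWith (Real.exp (L * s)).toNNReal
      (fun x : Metric.ball x₀ δ => flowMap f s x) := by
    refine AntilipschitzWith.of_le_mul_dist fun x y => ?_
    rw [Real.coe_toNNReal _ (Real.exp_pos _).le, mul_comm]
    exact (isForwardSolution_flowMap hc (x : EuclideanSpace ℝ (Fin n))).dist_le_backward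
      (isForwardSolution_flowMap hc y) hL hs.1
      (fun t ht => hC x x.2 t ⟨ht.1, ht.2.trans hs.2⟩)
      (fun t ht => hC y y.2 t ⟨ht.1, ht.2.trans hs.2⟩)
  rw [ae_restrict_iff' Metric.isOpen_ball.measurableSet, ae_iff,
    measure_eq_zero_iff_hausdorffMeasure]
  have h1 := hanti.hausdorffMeasure_preimage_le
    (d := Module.finrank ℝ (EuclideanSpace ℝ (Fin n))) (Nat.cast_nonneg _) N
  rw [(measure_eq_zero_iff_hausdorffMeasure N).1 hN, mul_zero, nonpos_iff_eq_zero,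
    ← (isometry_subtype_coe (s := Metric.ball x₀ δ)).hausdorffMeasure_image
      (Or.inl (Nat.cast_nonneg _))] at h1
  refine measure_mono_null (fun x hx => ?_) h1
  simp only [mem_ofPred_eq, Classical.not_imp, not_not] at hx
  exact ⟨⟨x, hx.1⟩, hx.2, rfl⟩

theorem exists_lipschitzOnWith_flowMap (hf : LocallyLipschitz f) (hc : ForwardComplete f)
    (x : EuclideanSpace ℝ (Fin n)) (T : ℝ) :
    ∃ K : ℝ≥0, LipschitzOnWith K (fun s : ℝ => flowMap f s x) (Icc 0 T) := by
  have hcont : ContinuousOn (fun s : ℝ => f (flowMap f s x)) (Icc 0 T) :=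
    hf.continuous.comp_continuousOn
      ((continuousOn_flowMap_left hc x).mono Icc_subset_Ici_self)
  obtain ⟨C, hC⟩ := isCompact_Icc.exists_bound_of_continuousOn hcont
  refine ⟨C.toNNReal, Convex.lipschitzOnWith_of_nnnorm_hasDerivWithin_le (convex_Icc 0 T)
    (fun s hs => ((isForwardSolution_flowMap hc x).2 s hs.1).mono Icc_subset_Ici_self)
    fun s hs => ?_⟩
  rw [← NNReal.coe_le_coe]
  exact (hC s hs).trans (Real.le_coe_toNNReal C)

/-- A locally Lipschitz function whose derivative along the vector field vanishes almost
everywhere is constant along trajectories. Since the flow pulls null sets back to null sets,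
Fubini's theorem gives this for almost every starting point, and continuity for all. -/
theorem LocallyLipschitzOn.comp_flowMap_eq (hf : LocallyLipschitz f) (hc : ForwardComplete f)
    {Ω : Set (EuclideanSpace ℝ (Fin n))} (hΩ : IsOpen Ω)
    (hinv : ∀ x ∈ Ω, ∀ s : ℝ, 0 ≤ s → flowMap f s x ∈ Ω) (hw : LocallyLipschitzOn Ω w)
    (hae : ∀ᵐ x, x ∈ Ω → ∃ p : EuclideanSpace ℝ (Fin n) →L[ℝ] ℝ,
      HasFDerivAt w p x ∧ p (f x) = 0)
    {x₀ : EuclideanSpace ℝ (Fin n)} (hx₀ : x₀ ∈ Ω) {S : ℝ} (hS : 0 ≤ S) :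
    w (flowMap f S x₀) = w x₀ := by
  obtain ⟨δ, hδ, hnull⟩ := exists_ball_ae_flowMap_notMem hf hc x₀ S
  set bad : Set (EuclideanSpace ℝ (Fin n)) := {x | ¬(x ∈ Ω →
    ∃ p : EuclideanSpace ℝ (Fin n) →L[ℝ] ℝ, HasFDerivAt w p x ∧ p (f x) = 0)} with hbad
  set N := toMeasurable volume bad with hN
  have hN0 : volume N = 0 := by rw [hN, measure_toMeasurable]; exact hae
  have hNmeas : MeasurableSet N := measurableSet_toMeasurable _ _
  have hfub : ∀ᵐ x ∂(volume.restrict (Metric.ball x₀ δ)),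
      ∀ᵐ s ∂((volume : Measure ℝ).restrict (Icc 0 S)), flowMap f (max s 0) x ∉ N := by
    rw [Measure.ae_ae_comm]
    · rw [ae_restrict_iff' measurableSet_Icc]
      refine Eventually.of_forall fun s hs => ?_
      rw [max_eq_left hs.1]
      exact hnull N hN0 s hs
    · have hmeas : Measurable fun z : EuclideanSpace ℝ (Fin n) × ℝ =>
          flowMap f (max z.2 0) z.1 :=
        ((continuous_flowMap_max hf hc).comp continuous_swap).measurable
      exact hmeas hNmeas.compl
  have hgood : ∀ᵐ x, x ∈ Metric.ball x₀ δ → x ∈ Ω → w (flowMap f S x) = w x := by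
    rw [ae_restrict_iff' Metric.isOpen_ball.measurableSet] at hfub
    filter_upwards [hfub] with x hx hxδ hxΩ
    obtain ⟨K₁, hK₁⟩ := exists_lipschitzOnWith_flowMap hf hc x S
    have hcomp : IsCompact ((fun s : ℝ => flowMap f s x) '' Icc 0 S) :=
      isCompact_Icc.image_of_continuousOn
        ((continuousOn_flowMap_left hc x).mono Icc_subset_Ici_self)
    obtain ⟨K₂, hK₂⟩ := LocallyLipschitzOn.exists_lipschitzOnWith_of_compact hcomp
      (hw.mono (image_subset_iff.2 fun s hs => hinv x hxΩ s hs.1))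
    have hlip := (hK₂.comp hK₁ (mapsTo_image _ _))
    rw [← uIcc_of_le hS] at hlip
    obtain ⟨C, hC⟩ := hlip.absolutelyContinuousOnInterval.const_of_ae_hasDerivAt_zero (by
      have h1 := hx hxδ
      rw [ae_restrict_iff' measurableSet_Icc] at h1
      filter_upwards [h1, Measure.ae_ne volume 0] with s hs hs0 hsS
      rw [uIcc_of_le hS] at hsS
      have hspos : 0 < s := lt_of_le_of_ne hsS.1 (Ne.symm hs0)
      have h2 := hs hsS
      rw [max_eq_left hsS.1] at h2
      have h3 : flowMap f s x ∉ bad := fun hmem => h2 (subset_toMeasurable _ _ hmem)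
      simp only [hbad, mem_ofPred_eq, not_not] at h3
      obtain ⟨p, hp, hp0⟩ := h3 (hinv x hxΩ s hsS.1)
      have h4 := hp.comp_hasDerivAt s ((isForwardSolution_flowMap hc x).hasDerivAt hspos)
      rwa [hp0] at h4)
    have h5 := hC S (by simp)
    have h6 := hC 0 (by simp)
    simp only [Function.comp_apply, flowMap_zero hc] at h5 h6
    rw [h5, h6]
  -- the good points are dense, so the identity extends to `x₀` by continuity
  have hfreq : ∃ᶠ x in 𝓝 x₀, x ∈ Metric.ball x₀ δ → x ∈ Ω → w (flowMap f S x) = w x :=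
    mem_closure_iff_frequently.1 (Measure.dense_of_ae hgood x₀)
  have hcw : ∀ y ∈ Ω, ContinuousAt w y := fun y hy =>
    hw.continuousOn.continuousAt (hΩ.mem_nhds hy)
  have hcd : ContinuousAt (fun x => w (flowMap f S x) - w x) x₀ :=
    ((hcw _ (hinv x₀ hx₀ S hS)).comp (f := flowMap f S)
      (continuous_flowMap_right hf hc hS).continuousAt).sub (hcw x₀ hx₀)
  by_contra hne
  have hev := hcd.eventually_ne (sub_ne_zero.2 hne)
  obtain ⟨x, hx, hx1, hx2, hx3⟩ := (hfreq.and_eventually (hev.and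
    ((Metric.isOpen_ball.eventually_mem (Metric.mem_ball_self hδ)).and
      (hΩ.eventually_mem hx₀)))).exists
  exact hx1 (sub_eq_zero.2 (hx hx2 hx3))

/-- Uniqueness for the perturbed Lyapunov equation on a forward invariant open subset of the
region of attraction: the difference of two solutions is constant along trajectories. -/
theorem IsViscositySolutionOn.eqOn_of_lyapunov (hf : LocallyLipschitz f)
    (hc : ForwardComplete f) (hη : Continuous η) {Ω : Set (EuclideanSpace ℝ (Fin n))}
    (hΩ : IsOpen Ω) (hinv : ∀ x ∈ Ω, ∀ s : ℝ, 0 ≤ s → flowMap f s x ∈ Ω)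
    (hxeq : xeq ∈ Ω) (hattr : Ω ⊆ regionOfAttraction f xeq)
    (hv : IsViscositySolutionOn (lyapunovHamiltonian f η O) Ω v)
    (hw : IsViscositySolutionOn (lyapunovHamiltonian f η O) Ω w)
    (hreg : (LocallyLipschitzOn Ω v ∧ LocallyLipschitzOn Ω w) ∨ ContinuousOn O Ω)
    (heq : w xeq = v xeq) (hx : x ∈ Ω) : w x = v x := by
  have hconst : ∀ s : ℝ, 0 ≤ s → w (flowMap f s x) - v (flowMap f s x) = w x - v x := by
    intro s hs
    rcases hreg with ⟨hvl, hwl⟩ | hO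
    · refine LocallyLipschitzOn.comp_flowMap_eq (w := fun x => w x - v x) hf hc hΩ hinv
        ?_ ?_ hx hs
      · intro y hy
        obtain ⟨K₁, N₁, hN₁, h1⟩ := hwl hy
        obtain ⟨K₂, N₂, hN₂, h2⟩ := hvl hy
        exact ⟨K₁ + K₂, N₁ ∩ N₂, inter_mem hN₁ hN₂,
          (h1.mono inter_subset_left).sub (h2.mono inter_subset_right)⟩
      · filter_upwards [hvl.ae_differentiableAt hΩ, hwl.ae_differentiableAt hΩ]
          with y hy1 hy2 hyΩ
        refine ⟨_, (hy2 hyΩ).hasFDerivAt.sub (hy1 hyΩ).hasFDerivAt, ?_⟩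
        rw [_root_.sub_apply, hw.fderiv_apply_eq hyΩ (hy2 hyΩ).hasFDerivAt,
          hv.fderiv_apply_eq hyΩ (hy1 hyΩ).hasFDerivAt, sub_self]
    · have h1 := hw.sub_flowMap_eq_integral hf hc hη hΩ hinv hO hx hs
      have h2 := hv.sub_flowMap_eq_integral hf hc hη hΩ hinv hO hx hs
      linarith
  have hcont : ContinuousAt (fun x => w x - v x) xeq :=
    (hw.1.sub hv.1).continuousAt (hΩ.mem_nhds hxeq)
  have hlim : Tendsto (fun s : ℝ => w (flowMap f s x) - v (flowMap f s x)) atTop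
      (𝓝 (w xeq - v xeq)) := hcont.tendsto.comp (hattr hx)
  have hlim' : Tendsto (fun s : ℝ => w (flowMap f s x) - v (flowMap f s x)) atTop
      (𝓝 (w x - v x)) := by
    refine tendsto_const_nhds.congr' ?_
    filter_upwards [eventually_ge_atTop 0] with s hs using (hconst s hs).symm
  have := tendsto_nhds_unique hlim hlim'
  linarith

end FlowDerivative

/-! ### Smallness of the perturbation on the region of attraction -/

section Perturbation

variable {n : ℕ} {f : EuclideanSpace ℝ (Fin n) → EuclideanSpace ℝ (Fin n)}
  {η h u θ : EuclideanSpace ℝ (Fin n) → ℝ} {xeq x : EuclideanSpace ℝ (Fin n)}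

/-- On compact subsets of the region of attraction, trajectories converge uniformly to the
equilibrium and the accumulated cost is bounded uniformly in time. -/
theorem LocallyExponentiallyStable.exists_forall_of_isCompact (hf : LocallyLipschitz f)
    (hc : ForwardComplete f) (hη : LocallyLipschitz η) (hη0 : ∀ x, 0 ≤ η x)
    (hstab : LocallyExponentiallyStable f xeq) (hηeq : η xeq = 0)
    {K : Set (EuclideanSpace ℝ (Fin n))} (hK : IsCompact K)
    (hKD : K ⊆ regionOfAttraction f xeq) :
    ∃ B : ℝ, (∀ x ∈ K, ∀ t : ℝ, 0 ≤ t → ∫ s in (0 : ℝ)..t, η (flowMap f s x) ≤ B) ∧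
      ∀ ε > (0 : ℝ), ∃ T > (0 : ℝ), ∀ x ∈ K, ∀ t ≥ T, ‖flowMap f t x - xeq‖ ≤ ε := by
  have hηc := hη.continuous
  have key : ∀ ε > (0 : ℝ), ∃ T > (0 : ℝ), ∃ B : ℝ, ∀ x ∈ K,
      (∀ t ≥ T, ‖flowMap f t x - xeq‖ ≤ ε) ∧
      ∀ t : ℝ, 0 ≤ t → ∫ s in (0 : ℝ)..t, η (flowMap f s x) ≤ B := by
    intro ε hε
    obtain ⟨r, hr, hball⟩ := hstab.exists_ball hc hη hηeq hε
    refine hK.induction_on (p := fun A => ∃ T > (0 : ℝ), ∃ B : ℝ, ∀ x ∈ A,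
      (∀ t ≥ T, ‖flowMap f t x - xeq‖ ≤ ε) ∧
      ∀ t : ℝ, 0 ≤ t → ∫ s in (0 : ℝ)..t, η (flowMap f s x) ≤ B) ?_ ?_ ?_ ?_
    · exact ⟨1, one_pos, 0, fun x hx => absurd hx (notMem_empty x)⟩
    · rintro A A' hAA' ⟨T, hT, B, hB⟩
      exact ⟨T, hT, B, fun x hx => hB x (hAA' hx)⟩
    · rintro A A' ⟨T, hT, B, hB⟩ ⟨T', hT', B', hB'⟩
      refine ⟨max T T', lt_max_of_lt_left hT, max B B', ?_⟩
      rintro x (hx | hx)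
      · exact ⟨fun t ht => (hB x hx).1 t ((le_max_left _ _).trans ht),
          fun t ht => ((hB x hx).2 t ht).trans (le_max_left _ _)⟩
      · exact ⟨fun t ht => (hB' x hx).1 t ((le_max_right _ _).trans ht),
          fun t ht => ((hB' x hx).2 t ht).trans (le_max_right _ _)⟩
    · intro x hx
      obtain ⟨T, hT, hTx⟩ := ((eventually_gt_atTop (0 : ℝ)).and
        ((show Tendsto _ _ _ from hKD hx).eventually (Metric.ball_mem_nhds xeq hr))).exists
      have h1 : ∀ᶠ y in 𝓝 x, flowMap f T y ∈ Metric.ball xeq r :=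
        (continuous_flowMap_right hf hc hT.le).continuousAt.eventually
          (Metric.isOpen_ball.mem_nhds hTx)
      have hcont : Continuous fun y => ∫ s in (0 : ℝ)..T, η (flowMap f s y) :=
        (continuousOn_integral_flowMap hf hc hηc).comp_continuous
          (Continuous.prodMk_right T) fun y => ⟨hT.le, mem_univ _⟩
      have h2 : ∀ᶠ y in 𝓝 x, ∫ s in (0 : ℝ)..T, η (flowMap f s y) <
          (∫ s in (0 : ℝ)..T, η (flowMap f s x)) + 1 :=
        hcont.continuousAt.eventually (gt_mem_nhds (lt_add_one _))
      refine ⟨_, mem_nhdsWithin_of_mem_nhds (h1.and h2), T, hT,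
        (∫ s in (0 : ℝ)..T, η (flowMap f s x)) + 1 + ε, fun y hy => ?_⟩
      obtain ⟨hy1, hy2⟩ := hy
      have hyb := (hball _ (by
        rw [← dist_eq_norm]
        exact (Metric.mem_ball.1 hy1).le)).2
      refine ⟨fun t ht => ?_, fun t ht => ?_⟩
      · have := (hyb (t - T) (sub_nonneg.2 ht)).1
        rwa [← flowMap_add hf hc hT.le (sub_nonneg.2 ht), add_sub_cancel] at this
      · have h3 := integral_flowMap_mono hc hηc hη0 y ht
          (show t ≤ T + t by linarith)
        rw [integral_flowMap_add hf hc hηc hT.le ht] at h3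
        linarith [(hyb t ht).2]
  obtain ⟨_, _, B, hB⟩ := key 1 one_pos
  refine ⟨B, fun x hx => (hB x hx).2, fun ε hε => ?_⟩
  obtain ⟨T, hT, _, hB⟩ := key ε hε
  exact ⟨T, hT, fun x hx => (hB x hx).1⟩

/-- The derivative of `-log u` along the flow, for `u = T_t h - θ`. The semigroup identity writes
the increment of `T_t h` along the flow as a smooth factor, with derivative
`(η(x) - η(φ(t, x))) T_t h(x)`, plus an increment of `h` near `φ(t, x)`; the Lipschitz constants
of `h` and `θ` control the rest. -/
theorem abs_add_flowDini_neg_log_le (hf : LocallyLipschitz f) (hc : ForwardComplete f)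
    (hη : Continuous η) (hη0 : ∀ x, 0 ≤ η x) {t : ℝ} (ht : 0 ≤ t) (hu : Continuous u)
    (huθ : ∀ y, zubovKoopman f η t h y = u y + θ y) {l : ℝ≥0} (hl : LipschitzWith l θ)
    (hux : 0 < u x) {Λ : ℝ≥0} {N : Set (EuclideanSpace ℝ (Fin n))}
    (hN : N ∈ 𝓝 (flowMap f t x)) (hh : LipschitzOnWith Λ h N) {ε : ℝ}
    (hε : |η x - (η x - η (flowMap f t x)) * zubovKoopman f η t h x * (u x)⁻¹| +
      (Λ * ‖f (flowMap f t x)‖ + l * ‖f x‖) * (u x)⁻¹ < ε) :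
    |η x + flowDini f (fun y => -Real.log (u y)) x| ≤ ε := by
  set z := flowMap f t x with hz
  set I : ℝ → ℝ := fun s =>
    (∫ r in (0 : ℝ)..s, η (flowMap f r x)) - ∫ r in (0 : ℝ)..s, η (flowMap f r z) with hI
  set Z := zubovKoopman f η t h x with hZ
  set e₀ := Real.exp (-∫ r in (0 : ℝ)..t, η (flowMap f r x)) with he₀
  have he₀1 : e₀ ≤ 1 := Real.exp_le_one_iff.2
    (neg_nonpos.2 (integral_flowMap_nonneg hη0 x ht))
  have hI0 : I 0 = 0 := by simp [hI]
  -- the value of `T_t h` along the trajectory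
  have hkoop : ∀ s : ℝ, 0 ≤ s → zubovKoopman f η t h (flowMap f s x) =
      Real.exp (I s) * (e₀ * h (flowMap f s z)) := by
    intro s hs
    have h1 := zubovKoopman_add (h := h) hf hc hη hs ht x
    have h2 := zubovKoopman_add (h := h) hf hc hη ht hs x
    rw [add_comm s t, h2] at h1
    have h3 : zubovKoopman f η t h (flowMap f s x) =
        Real.exp (∫ r in (0 : ℝ)..s, η (flowMap f r x)) *
          (Real.exp (-∫ r in (0 : ℝ)..s, η (flowMap f r x)) *
            zubovKoopman f η t h (flowMap f s x)) := by
      rw [← mul_assoc, ← Real.exp_add, add_neg_cancel, Real.exp_zero, one_mul]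
    rw [h3, ← h1]
    simp only [hI, sub_eq_add_neg, Real.exp_add, zubovKoopman]
    ring
  have hZ' : Z = e₀ * h z := rfl
  have hIder : HasDerivWithinAt (fun s => Real.exp (I s)) (η x - η z) (Ioi 0) 0 := by
    have h1 := ((hasDerivWithinAt_integral_flowMap hc hη x le_rfl).fun_sub
      (hasDerivWithinAt_integral_flowMap hc hη z le_rfl)).exp.mono Ioi_subset_Ici_self
    simpa [flowMap_zero hc] using h1
  have hA : Tendsto (fun s => (Real.exp (I s) - 1) / s * Z) (𝓝[>] 0)
      (𝓝 ((η x - η z) * Z)) := by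
    have h1 := (hasDerivWithinAt_iff_tendsto_slope' self_notMem_Ioi).1 hIder
    refine Tendsto.mul_const _ (h1.congr fun s => ?_)
    rw [slope_def_field, hI0, Real.exp_zero, sub_zero]
  have hexp : Tendsto (fun s => Real.exp (I s)) (𝓝[>] 0) (𝓝 1) := by
    have := hIder.continuousWithinAt
    rwa [ContinuousWithinAt, hI0, Real.exp_zero] at this
  have hR : Tendsto (fun s : ℝ => Real.exp (I s) * (Λ * (‖flowMap f s z - z‖ / s)) +
      l * (‖flowMap f s x - x‖ / s)) (𝓝[>] 0) (𝓝 (1 * (Λ * ‖f z‖) + l * ‖f x‖)) :=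
    (hexp.mul ((tendsto_norm_flowMap_sub_div hc z).const_mul _)).add
      ((tendsto_norm_flowMap_sub_div hc x).const_mul _)
  have hκ : Tendsto (fun s => dslope Real.log (u x) (u (flowMap f s x))) (𝓝[>] 0)
      (𝓝 (u x)⁻¹) := by
    have h1 : ContinuousAt (dslope Real.log (u x)) (u x) :=
      continuousAt_dslope_same.2 (Real.differentiableAt_log hux.ne')
    rw [ContinuousAt, dslope_same, Real.deriv_log] at h1
    exact h1.comp ((hu.tendsto x).comp (tendsto_flowMap_zero hc x))
  have hlim := ((hκ.mul hA).const_sub (η x)).abs.add (hκ.mul hR)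
  have hbound : ∀ᶠ s in 𝓝[>] (0 : ℝ),
      |η x + (-Real.log (u (flowMap f s x)) - -Real.log (u x)) / s| ≤ ε := by
    have hlt : |η x - (u x)⁻¹ * ((η x - η z) * Z)| +
        (u x)⁻¹ * (1 * (Λ * ‖f z‖) + l * ‖f x‖) < ε := by
      convert hε using 2
      · congr 2
        ring
      · ring
    filter_upwards [hlim.eventually (gt_mem_nhds hlt),
      hκ.eventually (lt_mem_nhds (inv_pos.2 hux)), self_mem_nhdsWithin,
      (tendsto_flowMap_zero hc z).eventually hN] with s hs hκs (hs0 : 0 < s) hsN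
    refine le_trans ?_ hs.le
    set k := dslope Real.log (u x) (u (flowMap f s x)) with hk
    set A := (Real.exp (I s) - 1) / s * Z with hAdef
    set q := (u (flowMap f s x) - u x) / s with hq
    have h1 : (-Real.log (u (flowMap f s x)) - -Real.log (u x)) / s = -(k * q) := by
      have := sub_smul_dslope Real.log (u x) (u (flowMap f s x))
      rw [smul_eq_mul] at this
      rw [hq, hk, neg_sub_neg, ← neg_sub, ← this]
      ring
    have h2 : |q - A| ≤ Real.exp (I s) * (Λ * (‖flowMap f s z - z‖ / s)) +
        l * (‖flowMap f s x - x‖ / s) := by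
      have h3 : q - A = (Real.exp (I s) * (e₀ * (h (flowMap f s z) - h z)) -
          (θ (flowMap f s x) - θ x)) / s := by
        have h4 := hkoop s hs0.le
        have h5 := huθ (flowMap f s x)
        have h6 := huθ x
        have h7 : u (flowMap f s x) - u x = (Real.exp (I s) - 1) * Z +
            (Real.exp (I s) * (e₀ * (h (flowMap f s z) - h z)) -
              (θ (flowMap f s x) - θ x)) := by
          rw [h4] at h5
          linear_combination -h5 + h6 - Real.exp (I s) * hZ' + hZ
        rw [hq, hAdef, h7]
        field_simp
        ring
      have h8 : |h (flowMap f s z) - h z| ≤ Λ * ‖flowMap f s z - z‖ := by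
        have := hh.dist_le_mul _ hsN _ (mem_of_mem_nhds hN)
        rwa [Real.dist_eq, dist_eq_norm] at this
      have h9 : |θ (flowMap f s x) - θ x| ≤ l * ‖flowMap f s x - x‖ := by
        have := hl.dist_le_mul (flowMap f s x) x
        rwa [Real.dist_eq, dist_eq_norm] at this
      rw [h3, abs_div, abs_of_pos hs0, div_le_iff₀ hs0]
      have h10 : |Real.exp (I s) * (e₀ * (h (flowMap f s z) - h z))| ≤
          Real.exp (I s) * (Λ * ‖flowMap f s z - z‖) := by
        rw [abs_mul, abs_mul, abs_of_pos (Real.exp_pos _), abs_of_pos (Real.exp_pos _)]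
        exact mul_le_mul_of_nonneg_left
          ((mul_le_of_le_one_left (abs_nonneg _) he₀1).trans h8) (Real.exp_pos _).le
      refine (abs_sub _ _).trans ((add_le_add h10 h9).trans (le_of_eq ?_))
      field_simp
    rw [h1]
    have h11 : η x + -(k * q) = (η x - k * A) - k * (q - A) := by ring
    rw [h11]
    refine (abs_sub _ _).trans ?_
    rw [abs_mul, abs_of_pos hκs]
    gcongr
  have hmem := flowDini_mem_Icc (f := f) (v := fun y => -Real.log (u y)) (x := x)
    (a := -ε - η x) (b := ε - η x) (hbound.mono fun s hs => by
      have := abs_le.1 hs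
      exact ⟨by linarith [this.1], by linarith [this.2]⟩)
  exact abs_le.2 ⟨by linarith [hmem.1], by linarith [hmem.2]⟩

/-- On a compact subset of the region of attraction, the perturbation is small as soon as `t` is
large and the residual `θ` and its Lipschitz constant are small. -/
theorem exists_forall_abs_add_flowDini_le (hf : LocallyLipschitz f)
    (hc : ForwardComplete f) (hη : LocallyLipschitz η) (hη0 : ∀ x, 0 ≤ η x)
    (hh : LocallyLipschitz h) {C : ℝ} (hC : ∀ x, |h x| ≤ C) (hfeq : f xeq = 0)
    (hstab : LocallyExponentiallyStable f xeq) (hηeq : η xeq = 0) (hheq : h xeq = 1)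
    {K : Set (EuclideanSpace ℝ (Fin n))} (hK : IsCompact K)
    (hKD : K ⊆ regionOfAttraction f xeq) {ε : ℝ} (hε : 0 < ε) :
    ∃ T > (0 : ℝ), ∃ σ > (0 : ℝ), ∀ t ≥ T, ∀ u θ : EuclideanSpace ℝ (Fin n) → ℝ,
      Continuous u → (∀ y, zubovKoopman f η t h y = u y + θ y) →
      ∀ l : ℝ≥0, LipschitzWith l θ → (l : ℝ) ≤ σ → (∀ x ∈ K, |θ x| ≤ σ) →
      ∀ x ∈ K, 0 < u x ∧ |η x + flowDini f (fun y => -Real.log (u y)) x| ≤ ε := by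
  obtain ⟨B, hB, hunif⟩ := hstab.exists_forall_of_isCompact hf hc hη hη0 hηeq hK hKD
  have hC0 : 0 ≤ C := (abs_nonneg _).trans (hC xeq)
  obtain ⟨E₁, hE₁⟩ := hK.exists_bound_of_continuousOn hη.continuous.continuousOn
  obtain ⟨F₁, hF₁⟩ := hK.exists_bound_of_continuousOn hf.continuous.continuousOn
  set E := max E₁ 0 with hE
  set F := max F₁ 0 with hF
  have hE0 : 0 ≤ E := le_max_right _ _
  have hF0 : 0 ≤ F := le_max_right _ _
  -- a lower bound for `u` on `K`
  set m : ℝ := Real.exp (-B) / 4 with hm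
  have hm0 : 0 < m := by positivity
  obtain ⟨Λ, N, hN, hΛ⟩ := hh xeq
  set a : ℝ := ε * m / (4 * (C + Λ + 1)) with ha
  have hΛ0 : (0 : ℝ) ≤ Λ := Λ.2
  have ha0 : 0 < a := by positivity
  have haC : (C + Λ) * a ≤ ε * m / 4 := by
    rw [ha, ← mul_div_assoc, div_le_div_iff₀ (by positivity) (by norm_num)]
    have : 0 < ε * m := by positivity
    nlinarith
  have hnear : ∀ᶠ y in 𝓝 xeq, N ∈ 𝓝 y ∧ η y < a ∧ ‖f y‖ < a ∧ 1 / 2 < h y := by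
    have h1 : ∀ᶠ y in 𝓝 xeq, η y < a :=
      hη.continuous.continuousAt.eventually (gt_mem_nhds (by rwa [hηeq]))
    have h2 : ∀ᶠ y in 𝓝 xeq, ‖f y‖ < a :=
      hf.continuous.norm.continuousAt.eventually (gt_mem_nhds (by simpa [hfeq] using ha0))
    have h3 : ∀ᶠ y in 𝓝 xeq, 1 / 2 < h y :=
      hh.continuous.continuousAt.eventually (lt_mem_nhds (by rw [hheq]; norm_num))
    filter_upwards [eventually_mem_nhds_iff.2 hN, h1, h2, h3] with y a1 a2 a3 a4
      using ⟨a1, a2, a3, a4⟩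
  obtain ⟨ρ, hρ, hρball⟩ := Metric.eventually_nhds_iff.1 hnear
  obtain ⟨T, hT, hTK⟩ := hunif (ρ / 2) (half_pos hρ)
  set σ : ℝ := min m (ε * m / (4 * (E + F + 1))) with hσ
  have hσ0 : 0 < σ := by positivity
  have hσEF : (E + F) * σ ≤ ε * m / 4 := by
    have h1 := (le_div_iff₀ (by positivity)).1 (min_le_right m (ε * m / (4 * (E + F + 1))))
    rw [← hσ] at h1
    nlinarith
  refine ⟨T, hT, σ, hσ0, fun t ht u θ hu huθ l hl hlσ hθσ x hx => ?_⟩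
  have ht0 : 0 ≤ t := hT.le.trans ht
  obtain ⟨hzN, hηz, hfz, hhz⟩ := hρball (y := flowMap f t x) (by
    rw [dist_eq_norm]
    exact (hTK x hx t ht).trans_lt (half_lt_self hρ))
  set z := flowMap f t x with hz
  set Z := zubovKoopman f η t h x with hZ
  have hθx := abs_le.1 (hθσ x hx)
  have hZlow : 2 * m ≤ Z := by
    have h1 : Real.exp (-B) ≤ Real.exp (-∫ r in (0 : ℝ)..t, η (flowMap f r x)) :=
      Real.exp_le_exp.2 (neg_le_neg (hB x hx t ht0))
    calc 2 * m = Real.exp (-B) * (1 / 2) := by rw [hm]; ring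
      _ ≤ Real.exp (-∫ r in (0 : ℝ)..t, η (flowMap f r x)) * h z := by gcongr
      _ = Z := rfl
  have hZup : Z ≤ C := by
    have h1 : Real.exp (-∫ r in (0 : ℝ)..t, η (flowMap f r x)) ≤ 1 :=
      Real.exp_le_one_iff.2 (neg_nonpos.2 (integral_flowMap_nonneg hη0 x ht0))
    calc Z ≤ 1 * C := mul_le_mul h1 ((le_abs_self _).trans (hC z)) (by linarith) zero_le_one
      _ = C := one_mul C
  have humx : m ≤ u x := by
    have h1 := huθ x
    have h2 : σ ≤ m := min_le_left _ _
    linarith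
  have hux : 0 < u x := hm0.trans_le humx
  refine ⟨hux, abs_add_flowDini_neg_log_le hf hc hη.continuous hη0 ht0 hu huθ hl hux hzN hΛ ?_⟩
  have hηx : |η x| ≤ E := (hE₁ x hx).trans (le_max_left _ _)
  have hfx : ‖f x‖ ≤ F := (hF₁ x hx).trans (le_max_left _ _)
  have h1 : η x - (η x - η z) * Z * (u x)⁻¹ = (η z * Z - η x * θ x) * (u x)⁻¹ := by
    have h2 : Z = u x + θ x := huθ x
    field_simp
    rw [h2]
    ring
  rw [h1, abs_mul, abs_of_pos (inv_pos.2 hux), ← add_mul, ← div_eq_mul_inv, div_lt_iff₀ hux]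
  have h2 : |η z * Z - η x * θ x| ≤ a * C + E * σ := by
    refine (abs_sub _ _).trans (add_le_add ?_ ?_)
    · rw [abs_of_nonneg (mul_nonneg (hη0 z) (by linarith))]
      exact mul_le_mul hηz.le hZup (by linarith) ha0.le
    · rw [abs_mul]
      exact mul_le_mul hηx (hθσ x hx) (abs_nonneg _) hE0
  have h3 : (Λ : ℝ) * ‖f z‖ ≤ Λ * a := by gcongr
  have h4 : (l : ℝ) * ‖f x‖ ≤ σ * F := by gcongr
  have h5 : ε * m ≤ ε * u x := by gcongr
  have h6 : 0 < ε * m := by positivity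
  nlinarith

end Perturbation

/-! ### The approximation theorem -/

section Approximation

variable {n : ℕ} {f : EuclideanSpace ℝ (Fin n) → EuclideanSpace ℝ (Fin n)}
  {η h : EuclideanSpace ℝ (Fin n) → ℝ} {xeq x : EuclideanSpace ℝ (Fin n)}

theorem zubovKoopman_of_equilibrium (hf : LocallyLipschitz f) (hc : ForwardComplete f)
    (hfeq : f xeq = 0) (hηeq : η xeq = 0) {t : ℝ} (ht : 0 ≤ t) :
    zubovKoopman f η t h xeq = h xeq := by
  have h1 : ∫ r in (0 : ℝ)..t, η (flowMap f r xeq) = ∫ _ in (0 : ℝ)..t, (0 : ℝ) := by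
    refine intervalIntegral.integral_congr fun r hr => ?_
    rw [uIcc_of_le ht] at hr
    simp only [flowMap_of_eq_zero hf hc hfeq hr.1, hηeq]
  rw [zubovKoopman, h1, flowMap_of_eq_zero hf hc hfeq ht]
  simp

theorem abs_sub_zubovU_le {t ε a θ : ℝ} (ha : zubovKoopman f η t h x = a + θ)
    (hθ : dist 0 θ ≤ ε / 2) (hε : |zubovKoopman f η t h x - zubovU f η h x| ≤ ε / 2) :
    |a - zubovU f η h x| ≤ ε := by
  rw [Real.dist_eq, zero_sub, abs_neg] at hθ
  have h1 : a - zubovU f η h x = (zubovKoopman f η t h x - zubovU f η h x) - θ := by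
    rw [ha]
    ring
  rw [h1]
  exact (abs_sub _ _).trans (by linarith)

theorem eventually_coe_le_of_pos {σ : ℝ} (hσ : 0 < σ) : ∀ᶠ l : ℝ≥0 in 𝓝 0, (l : ℝ) ≤ σ :=
  (NNReal.continuous_coe.tendsto' 0 0 rfl).eventually (eventually_le_nhds hσ)

end Approximation

theorem mainTheorem3 {n : ℕ}
    (f : EuclideanSpace ℝ (Fin n) → EuclideanSpace ℝ (Fin n)) (hf : LocallyLipschitz f)
    (hcomplete : ForwardComplete f)
    (η : EuclideanSpace ℝ (Fin n) → ℝ) (hη : LocallyLipschitz η) (hη_nonneg : ∀ x, 0 ≤ η x)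
    (h : EuclideanSpace ℝ (Fin n) → ℝ) (hh : LocallyLipschitz h)
    (hh_bdd : ∃ C : ℝ, ∀ x, |h x| ≤ C) :
    -- the Cauchy problem: existence and uniqueness
    (IsFeynmanKacSolution f η h (fun z => zubovKoopman f η z.1 h z.2) ∧
      ∀ w : ℝ × EuclideanSpace ℝ (Fin n) → ℝ, IsFeynmanKacSolution f η h w →
        ∀ t : ℝ, 0 ≤ t → ∀ x, w (t, x) = zubovKoopman f η t h x) ∧
    -- the approximants
    ∀ (xeq : EuclideanSpace ℝ (Fin n)), f xeq = 0 → LocallyExponentiallyStable f xeq →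
      η xeq = 0 → (∀ x, x ≠ xeq → 0 < η x) →
      ∀ (u θ : ℝ → ℕ → EuclideanSpace ℝ (Fin n) → ℝ),
        (∀ t : ℝ, 0 < t → ∀ k, LocallyLipschitz (u t k) ∧ ∃ C : ℝ, ∀ x, |u t k x| ≤ C) →
        (∀ t : ℝ, 0 < t → (∀ k, Continuous (θ t k)) ∧ ∃ C : ℝ, ∀ k x, |θ t k x| ≤ C) →
        (∀ t : ℝ, 0 < t → ∀ k x, zubovKoopman f η t h x = u t k x + θ t k x) →
        (∀ t : ℝ, 0 < t → ∀ k, θ t k xeq = 0) →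
        (∀ t : ℝ, 0 < t → VanishesOnBoundedSets atTop (θ t)) →
        -- convergence to `U_h`: `k → ∞` first and then `t → ∞`, and jointly
        ((∀ r > (0 : ℝ), ∃ c > (0 : ℝ), ∀ x, r ≤ ‖x - xeq‖ → c ≤ η x) →
          (∀ ε > (0 : ℝ), ∃ T : ℝ, ∀ t ≥ T, ∀ Ω : Set (EuclideanSpace ℝ (Fin n)),
            Bornology.IsBounded Ω →
              ∀ᶠ k in atTop, ∀ x ∈ Ω, |u t k x - zubovU f η h x| ≤ ε) ∧
          (∀ Ω : Set (EuclideanSpace ℝ (Fin n)),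
            TendstoUniformlyOn (fun (z : ℝ × ℕ) => θ z.1 z.2) (fun _ => 0)
              (atTop ×ˢ atTop) Ω →
            TendstoUniformlyOn (fun (z : ℝ × ℕ) => u z.1 z.2) (zubovU f η h)
              (atTop ×ˢ atTop) Ω)) ∧
        -- the perturbed Lyapunov equation for `v = -log u`
        (h xeq = 1 →
          ∀ L : ℝ → ℕ → ℝ≥0, (∀ t : ℝ, 0 < t → ∀ k, LipschitzWith (L t k) (θ t k)) →
          (∀ t : ℝ, 0 < t → Tendsto (L t) atTop (𝓝 0)) →
          ∃ O : ℝ → ℕ → EuclideanSpace ℝ (Fin n) → ℝ,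
            (∀ t : ℝ, 0 < t → ∀ k,
              0 < u t k xeq ∧ -Real.log (u t k xeq) = 0 ∧
              IsViscositySolutionOn (lyapunovHamiltonian f η (O t k)) {x | 0 < u t k x}
                (fun x => -Real.log (u t k x)) ∧
              ∀ Ω : Set (EuclideanSpace ℝ (Fin n)), IsOpen Ω → xeq ∈ Ω →
                Ω ⊆ regionOfAttraction f xeq → Ω ⊆ {x | 0 < u t k x} →
                (∀ x ∈ Ω, ∀ s : ℝ, 0 ≤ s → flowMap f s x ∈ Ω) →
                ∀ w : EuclideanSpace ℝ (Fin n) → ℝ,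
                  (LocallyLipschitzOn Ω w ∨ ContinuousOn (O t k) Ω) →
                  IsViscositySolutionOn (lyapunovHamiltonian f η (O t k)) Ω w → w xeq = 0 →
                  ∀ x ∈ Ω, w x = -Real.log (u t k x)) ∧
            (∀ K : Set (EuclideanSpace ℝ (Fin n)), IsCompact K →
              K ⊆ regionOfAttraction f xeq → ∀ ε > (0 : ℝ), ∃ T : ℝ, ∀ t ≥ T,
                ∀ᶠ k in atTop, ∀ x ∈ K, 0 < u t k x ∧ |O t k x| ≤ ε) ∧
            (VanishesOnBoundedSets (atTop ×ˢ atTop) (fun (z : ℝ × ℕ) => θ z.1 z.2) →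
              Tendsto (fun z : ℝ × ℕ => L z.1 z.2) (atTop ×ˢ atTop) (𝓝 0) →
              ∀ K : Set (EuclideanSpace ℝ (Fin n)), IsCompact K →
                K ⊆ regionOfAttraction f xeq → ∀ ε > (0 : ℝ),
                ∀ᶠ z : ℝ × ℕ in atTop ×ˢ atTop, ∀ x ∈ K,
                  0 < u z.1 z.2 x ∧ |O z.1 z.2 x| ≤ ε)) := by
  have hηc := hη.continuous
  obtain ⟨C, hC⟩ := hh_bdd
  refine ⟨⟨isFeynmanKacSolution_zubovKoopman hf hcomplete hηc hh.continuous,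
    fun w hw t ht x => hw.eq_zubovKoopman hf hcomplete hηc ht x⟩, ?_⟩
  intro xeq hfeq hstab hηeq _ u θ hu _ huθ hθeq hθ
  refine ⟨fun hinf => ⟨fun ε hε => ?_, fun Ω hΩ => ?_⟩, fun hheq L hL hL0 => ?_⟩
  · obtain ⟨T, hT, hTε⟩ := exists_forall_abs_zubovKoopman_sub_zubovU_le hf hcomplete hη
      hη_nonneg hh.continuous hC hstab hηeq hinf (half_pos hε)
    refine ⟨T, fun t ht Ω hΩ => ?_⟩
    have ht0 := hT.trans_le ht
    filter_upwards [Metric.tendstoUniformlyOn_iff.1 (hθ t ht0 Ω hΩ) (ε / 2) (half_pos hε)]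
      with k hk x hx
    exact abs_sub_zubovU_le (huθ t ht0 k x) (hk x hx).le (hTε t ht x)
  · rw [Metric.tendstoUniformlyOn_iff] at hΩ ⊢
    intro ε hε
    obtain ⟨T, hT, hTε⟩ := exists_forall_abs_zubovKoopman_sub_zubovU_le hf hcomplete hη
      hη_nonneg hh.continuous hC hstab hηeq hinf (half_pos (half_pos hε))
    filter_upwards [hΩ (ε / 2 / 2) (half_pos (half_pos hε)),
      tendsto_fst.eventually (eventually_ge_atTop T)] with z hz hzT x hx
    rw [dist_comm, Real.dist_eq]
    exact (abs_sub_zubovU_le (huθ z.1 (hT.trans_le hzT) z.2 x) (hz x hx).le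
      (hTε z.1 hzT x)).trans_lt (half_lt_self hε)
  · have hueq : ∀ t : ℝ, 0 < t → ∀ k, u t k xeq = 1 := fun t ht k => by
      have h1 := huθ t ht k xeq
      rw [hθeq t ht k, add_zero, zubovKoopman_of_equilibrium hf hcomplete hfeq hηeq ht.le,
        hheq] at h1
      exact h1.symm
    refine ⟨fun t k x => η x + flowDini f (fun y => -Real.log (u t k y)) x, ?_, ?_, ?_⟩
    · intro t ht k
      have hlip : ∀ x ∈ {x | 0 < u t k x}, ∃ K : ℝ≥0, ∃ N ∈ 𝓝 x,
          LipschitzOnWith K (fun y => -Real.log (u t k y)) N := fun x hx =>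
        (hu t ht k).1.exists_lipschitzOnWith_neg_log hx
      have hvisc := isViscositySolutionOn_flowDini (η := η) hcomplete hlip
      refine ⟨by rw [hueq t ht k]; exact one_pos, by rw [hueq t ht k]; simp, hvisc, ?_⟩
      intro Ω hΩ hxΩ hattr hpos hinv w hreg hw hweq x hx
      refine IsViscositySolutionOn.eqOn_of_lyapunov hf hcomplete hηc hΩ hinv hxΩ hattr
        (hvisc.mono hpos) hw (hreg.imp_left fun hwl => ⟨fun y hy => ?_, hwl⟩) ?_ hx
      · obtain ⟨K, N, hN, hK⟩ := hlip y (hpos hy)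
        exact ⟨K, N, mem_nhdsWithin_of_mem_nhds hN, hK⟩
      · simp [hweq, hueq t ht k]
    · intro K hK hKD ε hε
      obtain ⟨T, hT, σ, hσ, hTσ⟩ := exists_forall_abs_add_flowDini_le hf hcomplete hη
        hη_nonneg hh hC hfeq hstab hηeq hheq hK hKD hε
      refine ⟨T, fun t ht => ?_⟩
      have ht0 := hT.trans_le ht
      filter_upwards [Metric.tendstoUniformlyOn_iff.1 (hθ t ht0 K hK.isBounded) σ hσ,
        (hL0 t ht0).eventually (eventually_coe_le_of_pos hσ)] with k hk hLk
      exact hTσ t ht (u t k) (θ t k) (hu t ht0 k).1.continuous (huθ t ht0 k) (L t k)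
        (hL t ht0 k) hLk fun x hx => by simpa [Real.dist_eq] using (hk x hx).le
    · intro hθj hLj K hK hKD ε hε
      obtain ⟨T, hT, σ, hσ, hTσ⟩ := exists_forall_abs_add_flowDini_le hf hcomplete hη
        hη_nonneg hh hC hfeq hstab hηeq hheq hK hKD hε
      filter_upwards [Metric.tendstoUniformlyOn_iff.1 (hθj K hK.isBounded) σ hσ,
        hLj.eventually (eventually_coe_le_of_pos hσ),
        tendsto_fst.eventually (eventually_ge_atTop T)] with z hz hLz hzT
      have hz0 := hT.trans_le hzT
      exact hTσ z.1 hzT (u z.1 z.2) (θ z.1 z.2) (hu z.1 hz0 z.2).1.continuous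
        (huθ z.1 hz0 z.2) (L z.1 z.2) (hL z.1 hz0 z.2) hLz fun x hx => by
          simpa [Real.dist_eq] using (hz x hx).le
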